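/- Let $\Omega,c,R>0$, and let $\boldsymbol x_1,\dots,\boldsymbol x_N\in\mathbb R^3$ be distinct, with $r_{j\ell}=|\boldsymbol x_j-\boldsymbol x_\ell|$. Put $f(k,r)=4\pi\,\frac{\sin(kr)}{kr}$ (equal to $4\pi$ when $kr=0$) and $$\Gamma_{j\ell}(s)=\frac1{ic}\int_0^\infty \frac{e^{-k^2R^2}}{\frac{s}{ic}+k}\,k^2 f(k,r_{j\ell})\,dk ,\qquad s\notin -i(0,\infty).$$ For $y>0$ let $A^{\mp}_{j\ell}(y)=\lim_{\varepsilon\to0^+} ic\,\Gamma_{j\ell}(-iy\pm\varepsilon)$, and denote by $A^\pm$ also the analytic continuations of these matrix-valued functions to $\mathbb C\setminus(-\infty,0]$; explicitly, $A^+_{j\ell}(y)$ equals $ic\,\Gamma_{j\ell}(-iy)$ for $\operatorname{Im}y<0$ and $ic\,\Gamma_{j\ell}(-iy)-2\pi i\,(y/c)^2e^{-y^2R^2/c^2}f(y/c,r_{j\ell})$ for $\operatorname{Im}y>0$, while $A^-_{j\ell}(y)$ equals $ic\,\Gamma_{j\ell}(-iy)$ for $\operatorname{Im}y>0$ and $ic\,\Gamma_{j\ell}(-iy)+2\pi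 i\,(y/c)^2e^{-y^2R^2/c^2}f(y/c,r_{j\ell})$ for $\operatorname{Im}y<0$. Let $\Omega_A=\{re^{i\theta}: r>0,\ -\pi/6\le\theta\le\pi/6\}$, let $D(\Omega,R_0)$ be the open disk of radius $R_0$ centered at $\Omega$, and put $$d_g^{\pm}(y)=\det\Big[(y-\Omega)I+\frac{g^2}{(2\pi)^3c}A^{\pm}(y)\Big].$$ Then there are $G_0>0$ and $0<R_0<\Omega\sin\frac{\pi}{8}$, depending only on $\Omega,c,R$ and $\boldsymbol x_1,\dots,\boldsymbol x_N$, such that for every $0<g<G_0$ the following holds. The functions $d_g^\pm$ are analytic on $\Omega_A\supset D(\Omega,R_0)$ (that is, in a neighborhood of each of its points). Counted with multiplicity, $d_g^+$ has exactly $N$ roots $y_1,\dots,y_N$ in $D(\Omega,R_0)$; they all lie in $\Omega_A$ and satisfy $\operatorname{Im}y_j>0$, and $d_g^+$ has no other roots in $\Omega_A$. Counted with multiplicity, $d_g^-$ has exactly $N$ roots in $D(\Omega,R_0)$, namely $\bar y_1,\dots,\bar y_N$, and no other roots in $\Omega_A$. -/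

import Mathlib

open Complex Filter Topology MeasureTheory

noncomputable section

namespace AtomField

/-- The function `f(k,r) = 4π sin(kr)/(kr)`, extended continuously by `4π` at `kr = 0`;
it is an entire function of the complex variable `k`. -/
def f (k : ℂ) (r : ℝ) : ℂ :=
  if k * r = 0 then 4 * Real.pi else 4 * Real.pi * Complex.sin (k * r) / (k * r)

/-- The function
`Γ(s) = (1 / (i c)) ∫₀^∞ e^{-k²R²} k² f(k,r) / (s/(i c) + k) dk`
for a pair of atoms at distance `r`; the integral converges absolutely for every `s` outside the
open negative imaginary axis. -/
def Gam (c R r : ℝ) (s : ℂ) : ℂ :=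
  1 / (I * c) *
    ∫ k in Set.Ioi (0 : ℝ),
      ((Real.exp (-(k ^ 2 * R ^ 2)) : ℝ) : ℂ) / (s / (I * c) + k) * (k : ℂ) ^ 2 * f k r

/-- The jump of `y ↦ i c Γ(-i y)` across the positive real axis (value above minus value below),
as an entire function of `y`: `2πi (y/c)² e^{-y²R²/c²} f(y/c, r)`. -/
def jump (c R r : ℝ) (y : ℂ) : ℂ :=
  2 * Real.pi * I * (y / c) ^ 2 * Complex.exp (-(y ^ 2 * R ^ 2 / c ^ 2)) * f (y / c) r

/-- Entry of `A⁺`: on the positive real axis it is the one-sided limit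
`lim_{ε → 0⁺} i c Γ(-i y - ε)`, and it is continued analytically from there: below the real axis
the continuation is `i c Γ(-i y)` itself, above the real axis the jump is subtracted. -/
def Aplus (c R r : ℝ) (y : ℂ) : ℂ :=
  if y.im < 0 then I * c * Gam c R r (-I * y)
  else if 0 < y.im then I * c * Gam c R r (-I * y) - jump c R r y
  else limUnder (𝓝[>] (0 : ℝ)) fun ε : ℝ => I * c * Gam c R r (-I * y - ε)

/-- Entry of `A⁻`: on the positive real axis it is the one-sided limit
`lim_{ε → 0⁺} i c Γ(-i y + ε)`, and it is continued analytically from there: above the real axis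
the continuation is `i c Γ(-i y)` itself, below the real axis the jump is added. -/
def Aminus (c R r : ℝ) (y : ℂ) : ℂ :=
  if 0 < y.im then I * c * Gam c R r (-I * y)
  else if y.im < 0 then I * c * Gam c R r (-I * y) + jump c R r y
  else limUnder (𝓝[>] (0 : ℝ)) fun ε : ℝ => I * c * Gam c R r (-I * y + ε)

/-- The matrix `A⁺(y)` of the atoms at `x₁, …, x_N`, with `r_{jℓ} = |x_j - x_ℓ|`. -/
def AplusMatrix {N : ℕ} (c R : ℝ) (x : Fin N → EuclideanSpace ℝ (Fin 3)) (y : ℂ) :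
    Matrix (Fin N) (Fin N) ℂ :=
  Matrix.of fun j l => Aplus c R (dist (x j) (x l)) y

/-- The matrix `A⁻(y)` of the atoms at `x₁, …, x_N`. -/
def AminusMatrix {N : ℕ} (c R : ℝ) (x : Fin N → EuclideanSpace ℝ (Fin 3)) (y : ℂ) :
    Matrix (Fin N) (Fin N) ℂ :=
  Matrix.of fun j l => Aminus c R (dist (x j) (x l)) y

/-- `det[(y - Ω) I + g²/((2π)³ c) A(y)]` for a matrix-valued function `A`. -/
def resDet {N : ℕ} (Ω c g : ℝ) (A : ℂ → Matrix (Fin N) (Fin N) ℂ) (y : ℂ) : ℂ :=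
  ((y - Ω) • (1 : Matrix (Fin N) (Fin N) ℂ)
    + ((g ^ 2 / ((2 * Real.pi) ^ 3 * c) : ℝ) : ℂ) • A y).det

/-- The closed sector `Ω_A` of half-opening `π/6` around the positive real axis, without its
vertex. -/
def sectorA : Set ℂ :=
  {z | ∃ ρ θ : ℝ, 0 < ρ ∧ -(Real.pi / 6) ≤ θ ∧ θ ≤ Real.pi / 6 ∧ z = ρ * Complex.exp (θ * I)}

/-- `y₁, …, y_N` are all the roots of `F` in `S`, each listed as often as its multiplicity:
`F` is analytic at the points of `S`, the `y_j` are in `S`, the zeros of `F` in `S` are exactly the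
`y_j`, and the order of vanishing of `F` at any `z ∈ S` is the number of `j` with `y_j = z`. -/
def ListsRoots {N : ℕ} (F : ℂ → ℂ) (S : Set ℂ) (y : Fin N → ℂ) : Prop :=
  AnalyticOnNhd ℂ F S ∧ (∀ j, y j ∈ S) ∧
    ∀ z ∈ S, (F z = 0 ↔ ∃ j, y j = z) ∧
      analyticOrderAt F z = ((Finset.univ.filter fun j => y j = z).card : ℕ∞)

end AtomField

end

/-!
Write `A⁺(y)` as a Cauchy integral over the half line `k > 0` of the entire function
`e^{-k²R²} k² f(k, r)` with its pole at `y / c`. Rotating the contour to the ray through `4 + 3i`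
continues it to a bounded analytic function on a sector around the positive real axis, and the
reflection `y ↦ ȳ` turns it into `A⁻`, which differs from it by the residue. So
`A⁺(Ω) - A⁺(Ω)ᴴ` is a negative imaginary multiple of the matrix `f(Ω/c, |x_j - x_ℓ|)`, and this is
the Gram matrix in `L²(S²)` of the plane waves with frequency `Ω/c` and positions `x_j`. The waves
are linearly independent because on the complexified great circle through the direction of a
farthest point its wave outgrows the others. Hence `A⁺` is strictly dissipative near `Ω`, which
forces `Im y > 0` at the roots of `d_g⁺` there. For small `g`, comparison with `(y - Ω) ^ N` gives
`N` roots in the disk by Rouché's theorem, and none in the rest of the sector because `A⁺` is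
bounded. Conjugation gives the roots of `d_g⁻`.
-/

namespace AtomField

/-! ### Contour rotation -/

section ContourRotation

/-- The contour integral `∫ F(k) dk` along the half line from `0` in the direction `e`. -/
noncomputable def rayIntegral (e : ℂ) (F : ℂ → ℂ) : ℂ :=
  ∫ t in Set.Ioi (0 : ℝ), e * F (e * t)

variable {S : ConvexCone ℝ ℂ} {F : ℂ → ℂ} {C : ℝ} {a b e : ℂ}

lemma integrableOn_Ioi_of_norm_mul_le {φ : ℝ → ℂ} (hφ : ContinuousOn φ (Set.Ici 0))
    (hC : ∀ t, 0 ≤ t → ‖φ t‖ * (1 + t ^ 2) ≤ C) : IntegrableOn φ (Set.Ioi 0) := by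
  refine Integrable.mono' (g := fun t : ℝ => C * (1 + t ^ 2)⁻¹)
    ((integrable_inv_one_add_sq.const_mul C).integrableOn)
    ((hφ.mono Set.Ioi_subset_Ici_self).aestronglyMeasurable measurableSet_Ioi) ?_
  filter_upwards [ae_restrict_mem measurableSet_Ioi] with t ht
  rw [← div_eq_mul_inv, le_div_iff₀ (by positivity)]
  exact hC t (le_of_lt ht)

lemma mul_ofReal_mem (hS : S.Pointed) (he : e ∈ S) {t : ℝ} (ht : 0 ≤ t) : e * t ∈ S := by
  rcases ht.eq_or_lt with rfl | ht
  · simpa [ConvexCone.Pointed] using hS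
  · rw [mul_comm, ← real_smul]
    exact S.smul_mem ht he

lemma integrableOn_mul_comp_mul_ofReal (hS : S.Pointed) (he : e ∈ S) (he₀ : e ≠ 0)
    (hF : ContinuousOn F S) (hC : ∀ k ∈ S, ‖F k‖ * (1 + ‖k‖ ^ 2) ≤ C) :
    IntegrableOn (fun t : ℝ => e * F (e * t)) (Set.Ioi 0) := by
  refine integrableOn_Ioi_of_norm_mul_le (C := ‖e‖ * (1 + ‖e‖⁻¹ ^ 2) * C)
    (continuousOn_const.mul (hF.comp (by fun_prop) fun t ht => mul_ofReal_mem hS he ht))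
    fun t ht => ?_
  have bound := hC _ (mul_ofReal_mem hS he ht)
  rw [norm_mul e (t : ℂ), norm_real, Real.norm_of_nonneg ht] at bound
  calc ‖e * F (e * t)‖ * (1 + t ^ 2)
      ≤ ‖e‖ * ‖F (e * t)‖ * ((1 + ‖e‖⁻¹ ^ 2) * (1 + (‖e‖ * t) ^ 2)) := by
        rw [norm_mul]
        gcongr
        have : ‖e‖⁻¹ ^ 2 * (‖e‖ * t) ^ 2 = t ^ 2 := by
          have := norm_ne_zero_iff.2 he₀
          field_simp
        nlinarith [sq_nonneg ‖e‖⁻¹, sq_nonneg (‖e‖ * t)]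
    _ = ‖e‖ * (1 + ‖e‖⁻¹ ^ 2) * (‖F (e * t)‖ * (1 + (‖e‖ * t) ^ 2)) := by ring
    _ ≤ _ := by gcongr

lemma tendsto_primitive_rayIntegral {Q : ℂ → ℂ} (hS : S.Pointed) (he : e ∈ S) (he₀ : e ≠ 0)
    (hQ : ∀ k ∈ S, HasDerivWithinAt Q (F k) S k) (hF : ContinuousOn F S)
    (hC : ∀ k ∈ S, ‖F k‖ * (1 + ‖k‖ ^ 2) ≤ C) :
    Tendsto (fun T : ℝ => Q (e * T)) atTop (𝓝 (Q 0 + rayIntegral e F)) := by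
  have integrable := integrableOn_mul_comp_mul_ofReal hS he he₀ hF hC
  refine ((intervalIntegral_tendsto_integral_Ioi 0 integrable tendsto_id).const_add
    (Q 0)).congr' ?_
  filter_upwards [eventually_ge_atTop 0] with T hT
  have mapsTo : Set.MapsTo (fun t : ℝ => e * t) (Set.Ici 0) S := fun t ht =>
    mul_ofReal_mem hS he ht
  have deriv_line (t : ℝ) : HasDerivAt (fun s : ℝ => e * (s : ℂ)) e t := by
    simpa using (hasDerivAt_id t).ofReal_comp.const_mul e
  have ftc : ∫ t in (0 : ℝ)..T, e * F (e * t) = Q (e * T) - Q (e * (0 : ℝ)) := by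
    refine intervalIntegral.integral_eq_sub_of_hasDeriv_right_of_le
      (f := fun t : ℝ => Q (e * t)) hT ?_ (fun t ht => ?_)
      ((intervalIntegrable_iff_integrableOn_Ioc_of_le hT).2
        (integrable.mono_set Set.Ioc_subset_Ioi_self))
    · refine ContinuousOn.comp (fun k hk => (hQ k hk).continuousWithinAt) (by fun_prop) ?_
      exact mapsTo.mono_left Set.Icc_subset_Ici_self
    · have := (hQ _ (mapsTo ht.1.le)).scomp t (deriv_line t).hasDerivWithinAt
        (mapsTo.mono_left (Set.Ioi_subset_Ici ht.1.le))
      simpa [Function.comp_def] using this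
  simp [ftc]

lemma tendsto_primitive_sub_primitive {Q : ℂ → ℂ} (ha : a ∈ S) (hb : b ∈ S)
    (hab : (0 : ℂ) ∉ segment ℝ a b) (hQ : ∀ k ∈ S, HasDerivWithinAt Q (F k) S k)
    (hC : ∀ k ∈ S, ‖F k‖ * (1 + ‖k‖ ^ 2) ≤ C) :
    Tendsto (fun T : ℝ => Q (b * T) - Q (a * T)) atTop (𝓝 0) := by
  have segment_compact : IsCompact (segment ℝ a b) := by
    rw [← convexHull_pair]
    exact (Set.toFinite {a, b}).isCompact_convexHull ℝ
  obtain ⟨p, hp, norm_p_le⟩ := segment_compact.exists_isMinOn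
    ⟨a, left_mem_segment ℝ a b⟩ continuous_norm.continuousOn
  have norm_p_pos : 0 < ‖p‖ := norm_pos_iff.2 fun h => hab (h ▸ hp)
  refine squeeze_zero_norm' (a := fun T : ℝ => C / ‖p‖ ^ 2 * ‖b - a‖ / T) ?_
    (tendsto_const_nhds.div_atTop tendsto_id)
  filter_upwards [eventually_gt_atTop (0 : ℝ)] with T hT
  have segment_eq : segment ℝ (a * T) (b * T) = (fun k : ℂ => T • k) '' segment ℝ a b := by
    rw [mul_comm a, mul_comm b, ← real_smul, ← real_smul]
    exact (image_segment ℝ (LinearMap.lsmul ℝ ℂ T).toAffineMap a b).symm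
  have segment_subset : segment ℝ (a * T) (b * T) ⊆ S := by
    rw [segment_eq]
    rintro _ ⟨k, hk, rfl⟩
    exact S.smul_mem hT (S.convex.segment_subset ha hb hk)
  have norm_F_le : ∀ k ∈ segment ℝ (a * T) (b * T), ‖F k‖ ≤ C / (‖p‖ * T) ^ 2 := by
    intro k hk
    have bound := hC k (segment_subset hk)
    rw [segment_eq] at hk
    obtain ⟨q, hq, rfl⟩ := hk
    have : ‖p‖ * T ≤ ‖T • q‖ := by
      rw [norm_smul, Real.norm_of_nonneg hT.le, mul_comm]
      exact mul_le_mul_of_nonneg_left (norm_p_le hq) hT.le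
    rw [le_div_iff₀ (by positivity)]
    refine le_trans ?_ bound
    gcongr
    nlinarith [mul_pos norm_p_pos hT]
  calc ‖Q (b * T) - Q (a * T)‖ ≤ C / (‖p‖ * T) ^ 2 * ‖b * T - a * T‖ :=
        (convex_segment (a * T : ℂ) (b * T)).norm_image_sub_le_of_norm_hasDerivWithin_le
          (fun k hk => (hQ k (segment_subset hk)).mono segment_subset) norm_F_le
          (left_mem_segment _ _ _) (right_mem_segment _ _ _)
    _ = C / ‖p‖ ^ 2 * ‖b - a‖ / T := by
        rw [← sub_mul, norm_mul, norm_real, Real.norm_of_nonneg hT.le]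
        field_simp

theorem rayIntegral_eq_rayIntegral (hS : S.Pointed) (ha : a ∈ S) (hb : b ∈ S)
    (hab : (0 : ℂ) ∉ segment ℝ a b) (hF : DifferentiableOn ℂ F S)
    (hC : ∀ k ∈ S, ‖F k‖ * (1 + ‖k‖ ^ 2) ≤ C) : rayIntegral a F = rayIntegral b F := by
  obtain ⟨Q, hQ⟩ := S.convex.exists_forall_hasDerivWithinAt hF
  have ha₀ : a ≠ 0 := fun h => hab (h ▸ left_mem_segment ℝ a b)
  have hb₀ : b ≠ 0 := fun h => hab (h ▸ right_mem_segment ℝ a b)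
  have lim_sub := (tendsto_primitive_rayIntegral hS hb hb₀ hQ hF.continuousOn hC).sub
    (tendsto_primitive_rayIntegral hS ha ha₀ hQ hF.continuousOn hC)
  rw [add_sub_add_left_eq_sub] at lim_sub
  exact (sub_eq_zero.1
    (tendsto_nhds_unique lim_sub (tendsto_primitive_sub_primitive ha hb hab hQ hC))).symm

end ContourRotation

section LogarithmicIntegral

variable {w w₁ w₂ : ℂ} {t : ℝ}

lemma ofReal_add_mem_slitPlane (hw : w ∈ slitPlane) (ht : 0 ≤ t) : (t : ℂ) + w ∈ slitPlane := by
  rcases hw with hre | him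
  · exact Or.inl (by simpa using add_pos_of_nonneg_of_pos ht hre)
  · exact Or.inr (by simpa using him)

lemma ofReal_add_ne_zero (hw : w ∈ slitPlane) (ht : 0 ≤ t) : (t : ℂ) + w ≠ 0 :=
  slitPlane_ne_zero (ofReal_add_mem_slitPlane hw ht)

lemma exists_le_norm_ofReal_add (hw : w ∈ slitPlane) :
    ∃ δ : ℝ, 0 < δ ∧ ∀ t : ℝ, 0 ≤ t → δ ≤ ‖(t : ℂ) + w‖ := by
  rcases hw with hre | him
  · exact ⟨w.re, hre, fun t ht => le_trans (by simp [ht]) (re_le_norm _)⟩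
  · exact ⟨|w.im|, abs_pos.2 him, fun t _ => le_trans (by simp) (abs_im_le_norm _)⟩

lemma exists_one_add_le_mul_norm_ofReal_add (hw : w ∈ slitPlane) :
    ∃ B : ℝ, 0 < B ∧ ∀ t : ℝ, 0 ≤ t → 1 + t ≤ B * ‖(t : ℂ) + w‖ := by
  obtain ⟨δ, hδ, le_norm⟩ := exists_le_norm_ofReal_add hw
  refine ⟨1 + ‖1 - w‖ / δ, by positivity, fun t ht => ?_⟩
  have triangle : 1 + t ≤ ‖(t : ℂ) + w‖ + ‖1 - w‖ := by
    refine le_trans ?_ (norm_add_le _ _)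
    rw [show (t : ℂ) + w + (1 - w) = ((1 + t : ℝ) : ℂ) by push_cast; ring, norm_real]
    exact le_abs_self _
  have : ‖1 - w‖ ≤ ‖1 - w‖ / δ * ‖(t : ℂ) + w‖ := by
    rw [div_mul_eq_mul_div, le_div_iff₀ hδ]
    gcongr
    exact le_norm t ht
  linarith

lemma integrableOn_inv_ofReal_add_sub_inv (h₁ : w₁ ∈ slitPlane) (h₂ : w₂ ∈ slitPlane) :
    IntegrableOn (fun t : ℝ => ((t : ℂ) + w₁)⁻¹ - ((t : ℂ) + w₂)⁻¹) (Set.Ioi 0) := by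
  obtain ⟨B₁, _, one_add_le₁⟩ := exists_one_add_le_mul_norm_ofReal_add h₁
  obtain ⟨B₂, _, one_add_le₂⟩ := exists_one_add_le_mul_norm_ofReal_add h₂
  have continuousOn_inv {w : ℂ} (hw : w ∈ slitPlane) :
      ContinuousOn (fun t : ℝ => ((t : ℂ) + w)⁻¹) (Set.Ici 0) :=
    ContinuousOn.inv₀ (by fun_prop) fun t ht => ofReal_add_ne_zero hw ht
  refine integrableOn_Ioi_of_norm_mul_le (C := ‖w₂ - w₁‖ * (B₁ * B₂))
    ((continuousOn_inv h₁).sub (continuousOn_inv h₂)) fun t ht => ?_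
  have ne₁ := ofReal_add_ne_zero h₁ ht
  have ne₂ := ofReal_add_ne_zero h₂ ht
  rw [inv_sub_inv ne₁ ne₂, norm_div, norm_mul, div_mul_eq_mul_div,
    div_le_iff₀ (mul_pos (norm_pos_iff.2 ne₁) (norm_pos_iff.2 ne₂)),
    add_sub_add_left_eq_sub, mul_assoc]
  gcongr
  calc 1 + t ^ 2 ≤ (1 + t) * (1 + t) := by nlinarith
    _ ≤ (B₁ * ‖(t : ℂ) + w₁‖) * (B₂ * ‖(t : ℂ) + w₂‖) := by
      gcongr
      · exact one_add_le₁ t ht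
      · exact one_add_le₂ t ht
    _ = _ := by ring

lemma tendsto_log_ofReal_add_sub_log (w : ℂ) :
    Tendsto (fun t : ℝ => log ((t : ℂ) + w) - (Real.log t : ℂ)) atTop (𝓝 0) := by
  have lim_one : Tendsto (fun t : ℝ => 1 + w / (t : ℂ)) atTop (𝓝 1) := by
    have := ((continuous_ofReal.tendsto _).comp tendsto_inv_atTop_zero).const_mul w
    simpa [div_eq_mul_inv, Function.comp_def] using this.const_add 1
  have lim_log : Tendsto (fun t : ℝ => log (1 + w / (t : ℂ))) atTop (𝓝 0) := by
    rw [← log_one]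
    exact (continuousAt_clog (by simp)).tendsto.comp lim_one
  refine lim_log.congr' ?_
  filter_upwards [eventually_gt_atTop 0, lim_one.eventually_ne one_ne_zero] with t ht hne
  have factor : (t : ℂ) + w = (t : ℂ) * (1 + w / t) := by
    have : (t : ℂ) ≠ 0 := by exact_mod_cast ht.ne'
    field_simp
  rw [factor, log_ofReal_mul ht hne, add_sub_cancel_left]

theorem integral_Ioi_inv_ofReal_add_sub_inv (h₁ : w₁ ∈ slitPlane) (h₂ : w₂ ∈ slitPlane) :
    ∫ t in Set.Ioi (0 : ℝ), (((t : ℂ) + w₁)⁻¹ - ((t : ℂ) + w₂)⁻¹) = log w₂ - log w₁ := by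
  have deriv_log {w : ℂ} (hw : w ∈ slitPlane) {t : ℝ} (ht : 0 ≤ t) :
      HasDerivAt (fun s : ℝ => log ((s : ℂ) + w)) ((t : ℂ) + w)⁻¹ t := by
    simpa using ((hasDerivAt_id t).ofReal_comp.add_const w).clog_real
      (ofReal_add_mem_slitPlane hw ht)
  have lim : Tendsto (fun t : ℝ => log ((t : ℂ) + w₁) - log ((t : ℂ) + w₂)) atTop (𝓝 0) := by
    simpa using (tendsto_log_ofReal_add_sub_log w₁).sub (tendsto_log_ofReal_add_sub_log w₂)
  rw [integral_Ioi_of_hasDerivAt_of_tendsto'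
    (fun t ht => (deriv_log h₁ ht).sub (deriv_log h₂ ht))
    (integrableOn_inv_ofReal_add_sub_inv h₁ h₂) lim]
  simp

lemma mul_inv_mul_ofReal_sub {e : ℂ} (he : e ≠ 0) (z : ℂ) (t : ℝ) :
    e * (e * t - z)⁻¹ = ((t : ℂ) + -z / e)⁻¹ := by
  rw [show (t : ℂ) + -z / e = (e * t - z) / e by field_simp; ring, inv_div, div_eq_mul_inv]

end LogarithmicIntegral

section CauchyIntegral

/-- The closed cone of directions between the positive real axis and the ray through `4 + 3i`.
The contours rotate inside it; it lies in `|arg k| < π / 4`, where `k ↦ exp (-k ^ 2)` decays. -/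
def wedge : ConvexCone ℝ ℂ where
  carrier := {k | 0 ≤ k.im ∧ 4 * k.im ≤ 3 * k.re}
  smul_mem' c hc k hk := by
    simp only [Set.mem_ofPred_eq, smul_re, smul_im, smul_eq_mul] at hk ⊢
    constructor <;> nlinarith
  add_mem' k hk l hl := by
    simp only [Set.mem_ofPred_eq, add_re, add_im] at hk hl ⊢
    constructor <;> linarith

/-- The unit vector spanning the upper edge of `wedge`, the direction of the rotated contour. -/
noncomputable def ray : ℂ := ⟨4 / 5, 3 / 5⟩

/-- The Cauchy integral `∫ h(k) / (k - z) dk` along the half line in the direction `e`. -/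
noncomputable def rayCauchy (e : ℂ) (h : ℂ → ℂ) (z : ℂ) : ℂ :=
  rayIntegral e fun k => h k / (k - z)

/-- The Cauchy integrand `h(k) / (k - z)` with `h(z) / (k - z) - h(z) / (k + 1)` subtracted. It has
no pole at `z`, so its contour can be rotated, and the subtracted terms integrate to logarithms. -/
noncomputable def cauchyRemainder (h : ℂ → ℂ) (z k : ℂ) : ℂ :=
  dslope h z k + h z / (k + 1)

variable {h : ℂ → ℂ} {z e a b k : ℂ} {C : ℝ}

lemma mem_wedge : k ∈ wedge ↔ 0 ≤ k.im ∧ 4 * k.im ≤ 3 * k.re := Iff.rfl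

lemma pointed_wedge : wedge.Pointed := by
  simp [ConvexCone.Pointed, mem_wedge]

lemma isClosed_wedge : IsClosed (wedge : Set ℂ) :=
  (isClosed_le continuous_const continuous_im).inter
    (isClosed_le (continuous_const.mul continuous_im) (continuous_const.mul continuous_re))

lemma one_mem_wedge : 1 ∈ wedge := by
  simp [mem_wedge]

lemma ray_mem_wedge : ray ∈ wedge := by
  norm_num [mem_wedge, ray]

lemma norm_ray : ‖ray‖ = 1 := by
  rw [← sq_eq_sq₀ (norm_nonneg _) zero_le_one, Complex.sq_norm, normSq_apply]
  norm_num [ray]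

lemma ray_ne_zero : ray ≠ 0 := norm_pos_iff.1 (norm_ray ▸ one_pos)

lemma re_nonneg_of_mem_wedge (hk : k ∈ wedge) : 0 ≤ k.re := by
  rw [mem_wedge] at hk
  linarith

lemma re_pos_of_mem_wedge (hk : k ∈ wedge) (hk₀ : k ≠ 0) : 0 < k.re := by
  refine (re_nonneg_of_mem_wedge hk).lt_of_ne' fun hre => hk₀ (Complex.ext hre ?_)
  rw [mem_wedge, hre, mul_zero] at hk
  exact le_antisymm (nonpos_of_mul_nonpos_right hk.2 four_pos) hk.1

lemma add_one_ne_zero_of_mem_wedge (hk : k ∈ wedge) : k + 1 ≠ 0 := by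
  intro h₀
  have := congrArg re h₀
  rw [add_re, one_re, zero_re] at this
  linarith [re_nonneg_of_mem_wedge hk]

lemma norm_le_norm_add_one (hk : k ∈ wedge) : ‖k‖ ≤ ‖k + 1‖ := by
  have := re_nonneg_of_mem_wedge hk
  rw [← sq_le_sq₀ (norm_nonneg _) (norm_nonneg _), Complex.sq_norm, Complex.sq_norm,
    normSq_apply, normSq_apply, add_re, add_im, one_re, one_im]
  nlinarith

lemma zero_notMem_segment_of_mem_wedge (ha : a ∈ wedge) (ha₀ : a ≠ 0) (hb : b ∈ wedge)
    (hb₀ : b ≠ 0) : (0 : ℂ) ∉ segment ℝ a b := fun h₀ =>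
  lt_irrefl (0 : ℝ) <| (convex_halfSpace_re_gt 0).segment_subset
    (re_pos_of_mem_wedge ha ha₀) (re_pos_of_mem_wedge hb hb₀) h₀

lemma div_sub_eq_cauchyRemainder (hk : k ≠ z) :
    h k / (k - z) = cauchyRemainder h z k + h z * ((k - z)⁻¹ - (k - -1)⁻¹) := by
  rw [cauchyRemainder, dslope_of_ne _ hk, slope_def_field]
  ring

lemma differentiableOn_cauchyRemainder (hh : Differentiable ℂ h) :
    DifferentiableOn ℂ (cauchyRemainder h z) wedge := by
  have : Differentiable ℂ (dslope h z) := by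
    rw [← differentiableOn_univ] at hh ⊢
    exact (differentiableOn_dslope univ_mem).2 hh
  refine this.differentiableOn.add (DifferentiableOn.div (by fun_prop) (by fun_prop) ?_)
  exact fun k hk => add_one_ne_zero_of_mem_wedge hk

lemma norm_cauchyRemainder_mul_le (hhC : ∀ k ∈ wedge, ‖h k‖ * ‖k‖ ≤ C) (hk : k ∈ wedge)
    (hkz : 2 * ‖z‖ + 1 ≤ ‖k‖) :
    ‖cauchyRemainder h z k‖ * (1 + ‖k‖ ^ 2) ≤ 4 * (C + ‖h z‖ * ‖z + 1‖) := by
  have norm_k_pos : 0 < ‖k‖ := by linarith [norm_nonneg z]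
  have norm_k_le : ‖k‖ ≤ 2 * ‖k - z‖ := by linarith [norm_sub_norm_le k z]
  have sub_ne : k - z ≠ 0 := norm_pos_iff.1 (by linarith)
  have add_ne := add_one_ne_zero_of_mem_wedge hk
  have eq_div : cauchyRemainder h z k =
      h k / (k - z) - h z * (z + 1) / ((k + 1) * (k - z)) := by
    rw [div_sub_eq_cauchyRemainder (sub_ne_zero.1 sub_ne), sub_neg_eq_add]
    field_simp
    ring
  calc ‖cauchyRemainder h z k‖ * (1 + ‖k‖ ^ 2)
      ≤ (‖h k‖ / (‖k‖ / 2) + ‖h z‖ * ‖z + 1‖ / (‖k‖ * (‖k‖ / 2))) * (2 * ‖k‖ ^ 2) := by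
        rw [eq_div]
        gcongr
        · refine (norm_sub_le _ _).trans ?_
          rw [norm_div, norm_div, norm_mul, norm_mul]
          gcongr
          · linarith
          · exact norm_le_norm_add_one hk
          · linarith
        · nlinarith [norm_nonneg z]
    _ = 4 * (‖h k‖ * ‖k‖ + ‖h z‖ * ‖z + 1‖) := by
        field_simp
        ring
    _ ≤ _ := by
        gcongr
        exact hhC k hk

lemma exists_norm_cauchyRemainder_mul_le (hh : Differentiable ℂ h)
    (hhC : ∀ k ∈ wedge, ‖h k‖ * ‖k‖ ≤ C) (z : ℂ) :
    ∃ B : ℝ, ∀ k ∈ wedge, ‖cauchyRemainder h z k‖ * (1 + ‖k‖ ^ 2) ≤ B := by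
  obtain ⟨B, hB⟩ := ((isCompact_closedBall (0 : ℂ) (2 * ‖z‖ + 1)).inter_right
    isClosed_wedge).exists_bound_of_continuousOn
    (f := fun k => cauchyRemainder h z k * ((1 + ‖k‖ ^ 2 : ℝ) : ℂ)) <|
      ((differentiableOn_cauchyRemainder hh).continuousOn.mono Set.inter_subset_right).mul
        (by fun_prop)
  refine ⟨max B (4 * (C + ‖h z‖ * ‖z + 1‖)), fun k hk => ?_⟩
  rcases le_total ‖k‖ (2 * ‖z‖ + 1) with near | far
  · refine le_max_of_le_left ?_
    have := hB k ⟨by simpa using near, hk⟩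
    rwa [norm_mul, norm_real, Real.norm_of_nonneg (by positivity)] at this
  · exact le_max_of_le_right (norm_cauchyRemainder_mul_le hhC hk far)

lemma rayCauchy_eq_rayIntegral_cauchyRemainder (hh : Differentiable ℂ h)
    (hhC : ∀ k ∈ wedge, ‖h k‖ * ‖k‖ ≤ C) (he : e ∈ wedge) (he₀ : e ≠ 0)
    (hz : -z / e ∈ slitPlane) :
    rayCauchy e h z =
      rayIntegral e (cauchyRemainder h z) + h z * (log (1 / e) - log (-z / e)) := by
  obtain ⟨B, hB⟩ := exists_norm_cauchyRemainder_mul_le hh hhC z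
  have one_div_mem : 1 / e ∈ slitPlane := by
    refine Or.inl ?_
    rw [one_div, inv_re]
    exact div_pos (re_pos_of_mem_wedge he he₀) (normSq_pos.2 he₀)
  rw [rayCauchy, rayIntegral, rayIntegral, ← integral_Ioi_inv_ofReal_add_sub_inv hz one_div_mem,
    ← integral_const_mul, ← integral_add (integrableOn_mul_comp_mul_ofReal pointed_wedge he he₀
      (differentiableOn_cauchyRemainder hh).continuousOn hB)
      ((integrableOn_inv_ofReal_add_sub_inv hz one_div_mem).const_mul _)]
  refine setIntegral_congr_fun measurableSet_Ioi fun t (ht : 0 < t) => ?_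
  have hne : e * t ≠ z := by
    rintro rfl
    refine ofReal_add_ne_zero hz ht.le ?_
    field_simp
    ring
  change e * (h (e * t) / (e * t - z)) = _
  rw [div_sub_eq_cauchyRemainder hne, ← mul_inv_mul_ofReal_sub he₀ z, ← neg_neg (1 : ℂ),
    ← mul_inv_mul_ofReal_sub he₀ (-1)]
  ring

theorem rayCauchy_sub_rayCauchy (hh : Differentiable ℂ h) (hhC : ∀ k ∈ wedge, ‖h k‖ * ‖k‖ ≤ C)
    (ha : a ∈ wedge) (ha₀ : a ≠ 0) (hza : -z / a ∈ slitPlane) (hb : b ∈ wedge) (hb₀ : b ≠ 0)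
    (hzb : -z / b ∈ slitPlane) :
    rayCauchy a h z - rayCauchy b h z =
      h z * ((log (1 / a) - log (-z / a)) - (log (1 / b) - log (-z / b))) := by
  obtain ⟨B, hB⟩ := exists_norm_cauchyRemainder_mul_le hh hhC z
  rw [rayCauchy_eq_rayIntegral_cauchyRemainder hh hhC ha ha₀ hza,
    rayCauchy_eq_rayIntegral_cauchyRemainder hh hhC hb hb₀ hzb,
    rayIntegral_eq_rayIntegral pointed_wedge ha hb
      (zero_notMem_segment_of_mem_wedge ha ha₀ hb hb₀) (differentiableOn_cauchyRemainder hh) hB]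
  ring

end CauchyIntegral

section SectorBounds

/-- An open sector around the positive real axis containing `sectorA`, on which the Cauchy
integrals along `ray` are analytic and bounded: `ray` has slope `3/4`, the sector `2/3`. -/
def openSector : Set ℂ := {z | |z.im| < 2 / 3 * z.re}

variable {h : ℂ → ℂ} {z e : ℂ} {C t : ℝ}

lemma isOpen_openSector : IsOpen openSector :=
  isOpen_lt (continuous_abs.comp continuous_im) (continuous_const.mul continuous_re)

lemma re_pos_of_mem_openSector (hz : z ∈ openSector) : 0 < z.re := by
  have : |z.im| < 2 / 3 * z.re := hz
  linarith [abs_nonneg z.im]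

lemma conj_mem_openSector (hz : z ∈ openSector) : (starRingEnd ℂ) z ∈ openSector := by
  simpa [openSector] using hz

lemma ofReal_mem_openSector (ht : 0 < t) : (t : ℂ) ∈ openSector := by
  simpa [openSector] using ht

lemma neg_div_ray_mem_slitPlane (hz : z ∈ openSector) : -z / ray ∈ slitPlane := by
  have : |z.im| < 2 / 3 * z.re := hz
  refine Or.inr (ne_of_gt ?_)
  simp only [ray, div_im, neg_im, neg_re, normSq_mk]
  linarith [(abs_lt.1 this).2, re_pos_of_mem_openSector hz]

lemma re_div_le_norm_ray_mul_sub (hz : z ∈ openSector) (t : ℝ) :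
    z.re / 15 ≤ ‖ray * t - z‖ := by
  have : |z.im| < 2 / 3 * z.re := hz
  calc z.re / 15 ≤ ((starRingEnd ℂ) ray * (ray * t - z)).im := by
        simp only [ray, mul_im, conj_re, conj_im, sub_im, sub_re, mul_re, ofReal_re, ofReal_im]
        linarith [(abs_lt.1 this).2]
    _ ≤ ‖(starRingEnd ℂ) ray * (ray * t - z)‖ := (le_abs_self _).trans (abs_im_le_norm _)
    _ = ‖ray * t - z‖ := by rw [norm_mul, norm_conj, norm_ray, one_mul]

lemma ray_mul_sub_ne_zero (hz : z ∈ openSector) (t : ℝ) : ray * t - z ≠ 0 :=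
  norm_pos_iff.1 <|
    (div_pos (re_pos_of_mem_openSector hz) (by norm_num)).trans_le (re_div_le_norm_ray_mul_sub hz t)

lemma le_norm_ray_mul_sub (hz : z ∈ openSector) (ht : 0 ≤ t) : t ≤ 31 * ‖ray * t - z‖ := by
  have abs_im_lt : |z.im| < 2 / 3 * z.re := hz
  have norm_z_le : ‖z‖ ≤ 2 * z.re := by
    have := norm_le_abs_re_add_abs_im z
    rw [abs_of_pos (re_pos_of_mem_openSector hz)] at this
    linarith [re_pos_of_mem_openSector hz]
  have triangle : t ≤ ‖ray * t - z‖ + ‖z‖ := by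
    refine le_trans (le_of_eq ?_) (norm_add_le _ _)
    rw [sub_add_cancel, norm_mul, norm_ray, one_mul, norm_real, Real.norm_of_nonneg ht]
  linarith [re_div_le_norm_ray_mul_sub hz t]

lemma integrableOn_exp_neg_Ioi : IntegrableOn (fun t : ℝ => Real.exp (-t)) (Set.Ioi 0) := by
  simpa using exp_neg_integrableOn_Ioi 0 (b := 1) one_pos

lemma nonneg_of_norm_le_mul_exp (hhC : ∀ k ∈ wedge, ‖h k‖ ≤ C * ‖k‖ * Real.exp (-‖k‖)) : 0 ≤ C := by
  have : 0 ≤ C * Real.exp (-1) := by simpa using (norm_nonneg _).trans (hhC 1 one_mem_wedge)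
  exact nonneg_of_mul_nonneg_left this (Real.exp_pos _)

lemma norm_rayCauchy_integrand_le (hhC : ∀ k ∈ wedge, ‖h k‖ ≤ C * ‖k‖ * Real.exp (-‖k‖))
    (hz : z ∈ openSector) (ht : 0 ≤ t) :
    ‖ray * (h (ray * t) / (ray * t - z))‖ ≤ 31 * C * Real.exp (-t) := by
  have hC := nonneg_of_norm_le_mul_exp hhC
  have bound := hhC _ (mul_ofReal_mem pointed_wedge ray_mem_wedge ht)
  rw [norm_mul ray (t : ℂ), norm_ray, one_mul, norm_real, Real.norm_of_nonneg ht] at bound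
  rw [norm_mul, norm_ray, one_mul, norm_div,
    div_le_iff₀ (norm_pos_iff.2 (ray_mul_sub_ne_zero hz t))]
  calc ‖h (ray * t)‖ ≤ C * t * Real.exp (-t) := bound
    _ ≤ C * (31 * ‖ray * t - z‖) * Real.exp (-t) := by
        gcongr
        exact le_norm_ray_mul_sub hz ht
    _ = _ := by ring

lemma continuous_rayCauchy_integrand (hh : Differentiable ℂ h) (hz : z ∈ openSector) :
    Continuous fun t : ℝ => ray * (h (ray * t) / (ray * t - z)) := by
  have := hh.continuous
  exact continuous_const.mul (Continuous.div (by fun_prop) (by fun_prop) (ray_mul_sub_ne_zero hz))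

lemma integrableOn_rayCauchy (hh : Differentiable ℂ h)
    (hhC : ∀ k ∈ wedge, ‖h k‖ ≤ C * ‖k‖ * Real.exp (-‖k‖)) (hz : z ∈ openSector) :
    IntegrableOn (fun t : ℝ => ray * (h (ray * t) / (ray * t - z))) (Set.Ioi 0) :=
  Integrable.mono' (integrableOn_exp_neg_Ioi.const_mul (31 * C))
    (continuous_rayCauchy_integrand hh hz).aestronglyMeasurable <|
    (ae_restrict_mem measurableSet_Ioi).mono fun _ ht =>
      norm_rayCauchy_integrand_le hhC hz (le_of_lt ht)

theorem norm_rayCauchy_le (hhC : ∀ k ∈ wedge, ‖h k‖ ≤ C * ‖k‖ * Real.exp (-‖k‖))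
    (hz : z ∈ openSector) : ‖rayCauchy ray h z‖ ≤ 31 * C := by
  calc ‖rayCauchy ray h z‖ ≤ ∫ t in Set.Ioi (0 : ℝ), 31 * C * Real.exp (-t) :=
        norm_integral_le_of_norm_le (integrableOn_exp_neg_Ioi.const_mul (31 * C)) <|
          (ae_restrict_mem measurableSet_Ioi).mono fun _ ht =>
            norm_rayCauchy_integrand_le hhC hz (le_of_lt ht)
    _ = 31 * C := by rw [integral_const_mul, integral_exp_neg_Ioi_zero, mul_one]

theorem differentiableOn_rayCauchy (hh : Differentiable ℂ h)
    (hhC : ∀ k ∈ wedge, ‖h k‖ ≤ C * ‖k‖ * Real.exp (-‖k‖)) :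
    DifferentiableOn ℂ (rayCauchy ray h) openSector := by
  intro z₀ hz₀
  have hC := nonneg_of_norm_le_mul_exp hhC
  have hre := re_pos_of_mem_openSector hz₀
  have hs : openSector ∩ {z | z₀.re / 2 < z.re} ∈ 𝓝 z₀ :=
    (isOpen_openSector.inter (isOpen_lt continuous_const continuous_re)).mem_nhds
      ⟨hz₀, half_lt_self hre⟩
  refine (hasDerivAt_integral_of_dominated_loc_of_deriv_le (𝕜 := ℂ)
    (μ := volume.restrict (Set.Ioi (0 : ℝ))) (x₀ := z₀)
    (F := fun z (t : ℝ) => ray * (h (ray * t) / (ray * t - z)))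
    (F' := fun z (t : ℝ) => ray * (h (ray * t) / (ray * t - z)) * (ray * t - z)⁻¹)
    (bound := fun t => 31 * C * Real.exp (-t) * (30 / z₀.re)) hs
    (Filter.eventually_of_mem hs fun z hz =>
      (continuous_rayCauchy_integrand hh hz.1).aestronglyMeasurable)
    (integrableOn_rayCauchy hh hhC hz₀)
    ((continuous_rayCauchy_integrand hh hz₀).mul (Continuous.inv₀ (by fun_prop)
      (ray_mul_sub_ne_zero hz₀))).aestronglyMeasurable ?_
    ((integrableOn_exp_neg_Ioi.const_mul (31 * C)).mul_const _) ?_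
    ).2.differentiableAt.differentiableWithinAt
  · filter_upwards [ae_restrict_mem measurableSet_Ioi] with t ht z hz
    have norm_inv_le : ‖(ray * t - z)⁻¹‖ ≤ 30 / z₀.re := by
      have : z₀.re / 2 < z.re := hz.2
      rw [norm_inv, ← inv_div]
      exact inv_anti₀ (by positivity) (by linarith [re_div_le_norm_ray_mul_sub hz.1 t])
    rw [norm_mul]
    gcongr
    exact norm_rayCauchy_integrand_le hhC hz.1 (le_of_lt ht)
  · filter_upwards [ae_restrict_mem measurableSet_Ioi] with t _ z hz
    have hne := ray_mul_sub_ne_zero hz.1 t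
    have deriv_sub : HasDerivAt (fun z : ℂ => ray * t - z) (-1) z := by
      simpa using (hasDerivAt_id z).const_sub (ray * t)
    refine (((deriv_sub.inv hne).const_mul (h (ray * t))).const_mul ray).congr_deriv ?_
    field_simp

lemma log_neg_of_im_pos (hz : 0 < z.im) : log (-z) = log z - Real.pi * I := by
  rw [log, log, norm_neg, arg_neg_eq_arg_sub_pi_of_im_pos hz]
  push_cast
  ring

lemma log_neg_of_im_neg (hz : z.im < 0) : log (-z) = log z + Real.pi * I := by
  rw [log, log, norm_neg, arg_neg_eq_arg_add_pi_of_im_neg hz]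
  push_cast
  ring

lemma log_neg_div_ray (hz : z ∈ openSector) :
    log (-z / ray) = log z + log (1 / ray) + Real.pi * I := by
  have abs_im_lt : |z.im| < 2 / 3 * z.re := hz
  have hre := re_pos_of_mem_openSector hz
  have hz₀ : z ≠ 0 := fun h₀ => hre.ne' (by simp [h₀])
  have hray_re : 0 < (1 / ray).re := by
    simp only [ray, one_div, inv_re, normSq_mk]
    norm_num
  have him : (z * (1 / ray)).im < 0 := by
    simp only [ray, one_div, mul_im, inv_re, inv_im, normSq_mk]
    linarith [(abs_lt.1 abs_im_lt).2]
  rw [show -z / ray = -(z * (1 / ray)) by ring, log_neg_of_im_neg him,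
    (log_mul_eq_add_log_iff hz₀ (one_div_ne_zero ray_ne_zero)).2]
  have arg_z := abs_lt.1 (abs_arg_lt_pi_div_two_iff.2 (Or.inl hre))
  have arg_ray := abs_lt.1 (abs_arg_lt_pi_div_two_iff.2 (Or.inl hray_re))
  constructor <;> linarith

lemma rayCauchy_one_sub_rayCauchy_ray (hh : Differentiable ℂ h)
    (hhC : ∀ k ∈ wedge, ‖h k‖ * ‖k‖ ≤ C) (hz : z ∈ openSector) (him : z.im ≠ 0) :
    rayCauchy 1 h z - rayCauchy ray h z = h z * (log z + Real.pi * I - log (-z)) := by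
  have neg_mem : -z / 1 ∈ slitPlane := Or.inr (by simpa using him)
  rw [rayCauchy_sub_rayCauchy hh hhC one_mem_wedge one_ne_zero neg_mem
    ray_mem_wedge ray_ne_zero (neg_div_ray_mem_slitPlane hz), log_neg_div_ray hz, div_one, div_one,
    log_one]
  ring

theorem rayCauchy_one_of_im_neg (hh : Differentiable ℂ h)
    (hhC : ∀ k ∈ wedge, ‖h k‖ * ‖k‖ ≤ C) (hz : z ∈ openSector) (him : z.im < 0) :
    rayCauchy 1 h z = rayCauchy ray h z := by
  rw [← sub_eq_zero, rayCauchy_one_sub_rayCauchy_ray hh hhC hz him.ne, log_neg_of_im_neg him,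
    sub_self, mul_zero]

theorem rayCauchy_one_of_im_pos (hh : Differentiable ℂ h)
    (hhC : ∀ k ∈ wedge, ‖h k‖ * ‖k‖ ≤ C) (hz : z ∈ openSector) (him : 0 < z.im) :
    rayCauchy 1 h z = rayCauchy ray h z + 2 * Real.pi * I * h z := by
  rw [← sub_eq_iff_eq_add', rayCauchy_one_sub_rayCauchy_ray hh hhC hz him.ne',
    log_neg_of_im_pos him]
  ring

end SectorBounds

/-! ### Plane waves on the sphere -/

lemma hasSum_integral_cexp_mul {α : Type*} [MeasurableSpace α] {μ : Measure α} [IsFiniteMeasure μ]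
    {φ : α → ℝ} {B : ℝ} (hφ : AEStronglyMeasurable φ μ) (hφB : ∀ᵐ a ∂μ, |φ a| ≤ B) (z : ℂ) :
    HasSum (fun n : ℕ => z ^ n / n.factorial * (∫ a, φ a ^ n ∂μ : ℝ))
      (∫ a, cexp (z * φ a) ∂μ) := by
  have term_eq (n : ℕ) : z ^ n / n.factorial * (∫ a, φ a ^ n ∂μ : ℝ) =
      ∫ a, (z * φ a) ^ n / n.factorial ∂μ := by
    rw [← integral_complex_ofReal, ← integral_const_mul]
    congr 1 with a
    push_cast
    ring
  simp_rw [term_eq]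
  refine hasSum_integral_of_dominated_convergence (fun n _ => (‖z‖ * B) ^ n / n.factorial)
    (fun n => ?_) (fun n => hφB.mono fun a ha => ?_)
    (.of_forall fun _ => Real.summable_pow_div_factorial _) (integrable_const _)
    (.of_forall fun a => ?_)
  · simp only [div_eq_mul_inv]
    exact (((continuous_ofReal.comp_aestronglyMeasurable hφ).const_mul z).pow n).mul_const _
  · rw [norm_div, norm_pow, norm_mul, norm_real, Real.norm_eq_abs, norm_natCast]
    gcongr
  · rw [exp_eq_exp_ℂ]
    simpa [div_eq_inv_mul] using NormedSpace.exp_series_hasSum_exp' (𝕂 := ℂ) (z * φ a)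

lemma f_eq_integral_cexp (k : ℂ) (r : ℝ) :
    f k r = 2 * Real.pi * ∫ s in (-1 : ℝ)..1, cexp (I * k * (s * r : ℝ)) := by
  have integrand_eq (s : ℝ) : cexp (I * k * (s * r : ℝ)) = cexp (I * (k * r) * s) := by
    push_cast
    ring_nf
  simp_rw [integrand_eq]
  rw [f]
  split_ifs with hkr
  · simp only [hkr, mul_zero, zero_mul, Complex.exp_zero, intervalIntegral.integral_const]
    norm_num
    ring
  · rw [integral_exp_mul_complex (mul_ne_zero I_ne_zero hkr), Complex.sin]
    have := I_ne_zero
    field_simp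
    push_cast
    rw [I_sq]
    ring_nf

section SphereMoments

open Metric Module

lemma exists_orthonormalBasis_eq_norm_smul {E : Type*}
    [NormedAddCommGroup E] [InnerProductSpace ℝ E] {d : ℕ} (hd : finrank ℝ E = d + 1) (x : E) :
    ∃ b : OrthonormalBasis (Fin (d + 1)) ℝ E, x = ‖x‖ • b 0 := by
  have : FiniteDimensional ℝ E := .of_finrank_pos (hd ▸ d.succ_pos)
  rcases eq_or_ne x 0 with rfl | hx
  · exact ⟨(stdOrthonormalBasis ℝ E).reindex (finCongr hd), by simp⟩
  have norm_ne : ‖x‖ ≠ 0 := norm_ne_zero_iff.2 hx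
  obtain ⟨b, hb⟩ := Orthonormal.exists_orthonormalBasis_extension_of_card_eq (𝕜 := ℝ)
    (ι := Fin (d + 1)) (by simpa using hd) (v := fun _ => ‖x‖⁻¹ • x) (s := {0})
    ⟨fun _ => by simp [norm_smul, norm_ne], fun i j hij => absurd (Subsingleton.elim i j) hij⟩
  exact ⟨b, by rw [hb 0 rfl, smul_inv_smul₀ norm_ne]⟩

variable {E : Type*} [NormedAddCommGroup E] [MeasurableSpace E] [BorelSpace E]

theorem integral_eq_integral_toSphere_mul_integral_Ioi [NormedSpace ℝ E] [FiniteDimensional ℝ E]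
    [Nontrivial E] (μ : Measure E) [μ.IsAddHaarMeasure] {u : E → ℝ} {a : sphere (0 : E) 1 → ℝ}
    {b : ℝ → ℝ} (hu : ∀ (ω : sphere (0 : E) 1) (r : ℝ), 0 < r → u (r • (ω : E)) = a ω * b r) :
    ∫ p, u p ∂μ =
      (∫ ω, a ω ∂μ.toSphere) * ∫ r in Set.Ioi (0 : ℝ), r ^ (finrank ℝ E - 1) * b r :=
  calc
    ∫ p, u p ∂μ = ∫ p : ({(0)}ᶜ : Set E), u p ∂(μ.comap (↑)) := by
      rw [integral_subtype_comap (measurableSet_singleton _).compl u, restrict_compl_singleton]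
    _ = ∫ q : sphere (0 : E) 1 × Set.Ioi (0 : ℝ), a q.1 * b q.2
          ∂μ.toSphere.prod (.volumeIoiPow (finrank ℝ E - 1)) := by
      rw [← μ.measurePreserving_homeomorphUnitSphereProd.integral_comp
        (Homeomorph.measurableEmbedding _)]
      refine integral_congr_ae (.of_forall fun p => ?_)
      have norm_pos : 0 < ‖(p : E)‖ := norm_pos_iff.2 p.2
      simpa only [homeomorphUnitSphereProd_apply_fst_coe, smul_inv_smul₀ norm_pos.ne',
        homeomorphUnitSphereProd_apply_snd_coe] using
        hu (homeomorphUnitSphereProd E p).1 ‖(p : E)‖ norm_pos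
    _ = (∫ ω, a ω ∂μ.toSphere) *
          ∫ r : Set.Ioi (0 : ℝ), b r ∂.volumeIoiPow (finrank ℝ E - 1) :=
      integral_prod_mul a (fun r : Set.Ioi (0 : ℝ) => b r)
    _ = _ := by
      congr 1
      simp only [Measure.volumeIoiPow, ENNReal.ofReal]
      rw [integral_withDensity_eq_integral_smul,
        integral_subtype_comap measurableSet_Ioi
          fun r : ℝ ↦ Real.toNNReal (r ^ (finrank ℝ E - 1)) • b r,
        setIntegral_congr_fun measurableSet_Ioi fun r hr ↦ ?_]
      · rw [NNReal.smul_def, Real.coe_toNNReal _ (pow_nonneg hr.out.le _), smul_eq_mul]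
      · exact (measurable_subtype_coe.pow_const _).real_toNNReal

lemma integral_pow_mul_exp_neg_sq_Ioi (n : ℕ) :
    ∫ t in Set.Ioi (0 : ℝ), t ^ n * Real.exp (-t ^ 2) = 1 / 2 * Real.Gamma ((n + 1) / 2) := by
  rw [← integral_rpow_mul_exp_neg_rpow two_pos
    (show (-1 : ℝ) < n from neg_one_lt_zero.trans_le n.cast_nonneg)]
  exact setIntegral_congr_fun measurableSet_Ioi fun t _ => by simp

lemma integrable_pow_mul_exp_neg_sq (n : ℕ) :
    Integrable fun t : ℝ => t ^ n * Real.exp (-t ^ 2) := by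
  simpa using integrable_rpow_mul_exp_neg_mul_sq one_pos
    (show (-1 : ℝ) < n from neg_one_lt_zero.trans_le n.cast_nonneg)

lemma integral_pow_mul_exp_neg_sq (n : ℕ) :
    ∫ t : ℝ, t ^ n * Real.exp (-t ^ 2) = (1 + (-1) ^ n) * (1 / 2 * Real.Gamma ((n + 1) / 2)) := by
  have integrable := integrable_pow_mul_exp_neg_sq n
  have reflect := integral_comp_neg_Iic 0 fun t : ℝ => (-1) ^ n * (t ^ n * Real.exp (-t ^ 2))
  rw [neg_zero] at reflect
  rw [← intervalIntegral.integral_Iic_add_Ioi (b := 0) integrable.integrableOn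
    integrable.integrableOn, ← integral_pow_mul_exp_neg_sq_Ioi, one_add_mul, ← integral_const_mul,
    ← reflect, add_comm]
  congr 1
  refine setIntegral_congr_fun measurableSet_Iic fun t _ => ?_
  rw [← mul_assoc, ← mul_pow, neg_one_mul, neg_neg, neg_sq]

variable [InnerProductSpace ℝ E] [FiniteDimensional ℝ E]

theorem integral_inner_pow_mul_exp_neg_norm_sq {d : ℕ} (hd : finrank ℝ E = d + 1) (x : E)
    (n : ℕ) :
    ∫ p : E, inner ℝ p x ^ n * Real.exp (-‖p‖ ^ 2) =
      ‖x‖ ^ n * (∫ t : ℝ, t ^ n * Real.exp (-t ^ 2)) * √Real.pi ^ d := by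
  obtain ⟨b, hb⟩ := exists_orthonormalBasis_eq_norm_smul hd x
  rw [← b.measurePreserving_repr_symm.integral_comp
    b.repr.symm.toHomeomorph.measurableEmbedding,
    ← (PiLp.volume_preserving_toLp (Fin (d + 1))).integral_comp
    (MeasurableEquiv.toLp 2 (Fin (d + 1) → ℝ)).measurableEmbedding]
  let factor : Fin (d + 1) → ℝ → ℝ := Fin.cons (fun t => ‖x‖ ^ n * (t ^ n * Real.exp (-t ^ 2)))
    fun _ t => Real.exp (-t ^ 2)
  have eq_prod (q : Fin (d + 1) → ℝ) : inner ℝ (b.repr.symm (WithLp.toLp 2 q)) x ^ n *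
      Real.exp (-‖b.repr.symm (WithLp.toLp 2 q)‖ ^ 2) = ∏ i, factor i (q i) := by
    have inner_eq : inner ℝ (b.repr.symm (WithLp.toLp 2 q)) x = ‖x‖ * q 0 := by
      nth_rw 1 [hb]
      rw [inner_smul_right, real_inner_comm, ← b.repr_apply_apply,
        LinearIsometryEquiv.apply_symm_apply]
    have norm_sq_eq : ‖b.repr.symm (WithLp.toLp 2 q)‖ ^ 2 = q 0 ^ 2 + ∑ i, q (Fin.succ i) ^ 2 := by
      rw [LinearIsometryEquiv.norm_map, EuclideanSpace.norm_sq_eq, Fin.sum_univ_succ]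
      simp
    rw [inner_eq, norm_sq_eq, Fin.prod_univ_succ, mul_pow, neg_add, Real.exp_add,
      ← Finset.sum_neg_distrib, Real.exp_sum]
    simp only [factor, Fin.cons_zero, Fin.cons_succ]
    ring
  have gaussian : ∫ t : ℝ, Real.exp (-t ^ 2) = √Real.pi := by simpa using integral_gaussian 1
  simp_rw [eq_prod]
  rw [integral_fintype_prod_volume_eq_prod, Fin.prod_univ_succ]
  simp only [factor, Fin.cons_zero, Fin.cons_succ, gaussian, integral_const_mul,
    Finset.prod_const, Finset.card_univ, Fintype.card_fin]

theorem integral_inner_pow_toSphere (hd : finrank ℝ E = 3) (x : E) (n : ℕ) :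
    ∫ ω : sphere (0 : E) 1, inner ℝ (ω : E) x ^ n ∂(volume : Measure E).toSphere =
      2 * Real.pi * ∫ s in (-1 : ℝ)..1, (s * ‖x‖) ^ n := by
  have : Nontrivial E := nontrivial_of_finrank_pos (R := ℝ) (hd ▸ Nat.succ_pos 2)
  have gaussian := integral_inner_pow_mul_exp_neg_norm_sq hd x n
  rw [integral_eq_integral_toSphere_mul_integral_Ioi volume
    (a := fun ω => inner ℝ (ω : E) x ^ n) (b := fun r => r ^ n * Real.exp (-r ^ 2))
    (fun ω r hr => by
      rw [real_inner_smul_left, norm_smul, norm_eq_of_mem_sphere, mul_one,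
        Real.norm_of_nonneg hr.le]
      ring),
    integral_pow_mul_exp_neg_sq, Real.sq_sqrt Real.pi_pos.le, hd] at gaussian
  have radial : ∫ r in Set.Ioi (0 : ℝ), r ^ (3 - 1) * (r ^ n * Real.exp (-r ^ 2)) =
      1 / 2 * ((n + 1) / 2 * Real.Gamma ((n + 1) / 2)) := by
    rw [← Real.Gamma_add_one (by positivity),
      show ((n : ℝ) + 1) / 2 + 1 = (((n + 2 : ℕ) : ℝ) + 1) / 2 by push_cast; ring,
      ← integral_pow_mul_exp_neg_sq_Ioi]
    exact setIntegral_congr_fun measurableSet_Ioi fun t _ => by ring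
  have interval : ∫ s in (-1 : ℝ)..1, (s * ‖x‖) ^ n = ‖x‖ ^ n * (1 + (-1) ^ n) / (n + 1) := by
    simp_rw [mul_pow]
    rw [intervalIntegral.integral_mul_const, integral_pow]
    ring
  have gamma_pos : 0 < Real.Gamma (((n : ℝ) + 1) / 2) := Real.Gamma_pos_of_pos (by positivity)
  have succ_pos : (0 : ℝ) < n + 1 := by positivity
  rw [radial] at gaussian
  rw [interval, ← mul_div_assoc, eq_div_iff succ_pos.ne']
  refine mul_right_cancel₀ gamma_pos.ne' ?_
  linear_combination 4 * gaussian

theorem integral_cexp_mul_inner_toSphere (hd : finrank ℝ E = 3) (x : E) (z : ℂ) :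
    ∫ ω : sphere (0 : E) 1, cexp (z * (inner ℝ (ω : E) x : ℝ)) ∂(volume : Measure E).toSphere =
      2 * Real.pi * ∫ s in (-1 : ℝ)..1, cexp (z * (s * ‖x‖ : ℝ)) := by
  have sphere_moments := hasSum_integral_cexp_mul (μ := (volume : Measure E).toSphere)
    (φ := fun ω : sphere (0 : E) 1 => inner ℝ (ω : E) x) (B := ‖x‖)
    (Continuous.aestronglyMeasurable (by fun_prop)) (.of_forall fun ω => by
      simpa using abs_real_inner_le_norm (ω : E) x) z
  have interval_moments := hasSum_integral_cexp_mul (μ := volume.restrict (Set.Ioc (-1 : ℝ) 1))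
    (φ := fun s => s * ‖x‖) (B := ‖x‖) (Continuous.aestronglyMeasurable (by fun_prop))
    ((ae_restrict_mem measurableSet_Ioc).mono fun s hs => by
      rw [abs_mul, abs_norm]
      exact mul_le_of_le_one_left (norm_nonneg x) (abs_le.2 ⟨hs.1.le, hs.2⟩)) z
  rw [intervalIntegral.integral_of_le (by norm_num)]
  refine sphere_moments.unique ((interval_moments.mul_left (2 * Real.pi : ℂ)).congr_fun ?_)
  intro n
  rw [integral_inner_pow_toSphere hd, intervalIntegral.integral_of_le (by norm_num)]
  push_cast
  ring

theorem f_norm_eq_integral_toSphere (hd : finrank ℝ E = 3) (k : ℂ) (x : E) :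
    f k ‖x‖ = ∫ ω : sphere (0 : E) 1, cexp (I * k * (inner ℝ (ω : E) x : ℝ))
      ∂(volume : Measure E).toSphere := by
  rw [integral_cexp_mul_inner_toSphere hd, f_eq_integral_cexp]

end SphereMoments

section PlaneWaves

open Metric Module
open scoped ComplexOrder

lemma eq_zero_of_forall_ofReal {F : ℂ → ℂ} (hF : Differentiable ℂ F) (hF₀ : ∀ t : ℝ, F t = 0)
    (z : ℂ) : F z = 0 := by
  have tendsto_ofReal : Tendsto (fun t : ℝ => (t : ℂ)) (𝓝[≠] 0) (𝓝[≠] 0) := by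
    refine tendsto_nhdsWithin_of_tendsto_nhds_of_eventually_within _
      ((continuous_ofReal.tendsto' 0 0 (by simp)).mono_left nhdsWithin_le_nhds) ?_
    filter_upwards [self_mem_nhdsWithin] with t ht
    simpa using ht
  have analytic : AnalyticOnNhd ℂ F Set.univ := fun w _ => hF.analyticAt w
  exact analytic.eqOn_zero_of_preconnected_of_frequently_eq_zero isPreconnected_univ
    (Set.mem_univ 0) (tendsto_ofReal.frequently (Eventually.of_forall hF₀).frequently)
    (Set.mem_univ z)

lemma eq_zero_of_sum_eq_zero_of_norm_eq_mul_exp {ι F : Type*} [SeminormedAddCommGroup F]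
    {s : Finset ι} {w : ι → ℝ → F} {c a : ι → ℝ} {m : ι} (hm : m ∈ s)
    (hw : ∀ l ∈ s, ∀ τ, ‖w l τ‖ = c l * Real.exp (τ * a l)) (hsum : ∀ τ, ∑ l ∈ s, w l τ = 0)
    (ha : ∀ l ∈ s, l ≠ m → a l < a m) : c m = 0 := by
  classical
  have le_sum (τ : ℝ) : c m ≤ ∑ l ∈ s.erase m, c l * Real.exp (-(τ * (a m - a l))) := by
    have eq_neg := hsum τ
    rw [← Finset.add_sum_erase _ _ hm, add_eq_zero_iff_eq_neg] at eq_neg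
    have norm_le : c m * Real.exp (τ * a m) ≤ ∑ l ∈ s.erase m, c l * Real.exp (τ * a l) := by
      rw [← hw m hm, eq_neg, norm_neg]
      exact (norm_sum_le _ _).trans_eq <|
        Finset.sum_congr rfl fun l hl => hw l (Finset.mem_of_mem_erase hl) τ
    rw [← le_div_iff₀ (Real.exp_pos _), Finset.sum_div] at norm_le
    refine norm_le.trans_eq (Finset.sum_congr rfl fun l _ => ?_)
    rw [mul_div_assoc, ← Real.exp_sub]
    ring_nf
  have tendsto_sum : Tendsto (fun τ => ∑ l ∈ s.erase m, c l * Real.exp (-(τ * (a m - a l)))) atTop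
      (𝓝 (∑ l ∈ s.erase m, c l * 0)) := by
    refine tendsto_finsetSum _ fun l hl => (Real.tendsto_exp_neg_atTop_nhds_zero.comp
      (tendsto_id.atTop_mul_const (sub_pos.2 ?_))).const_mul (c l)
    exact ha l (Finset.mem_of_mem_erase hl) (Finset.ne_of_mem_erase hl)
  have nonneg : 0 ≤ c m := by
    simpa [hw m hm 0] using norm_nonneg (w m 0)
  refine le_antisymm ?_ nonneg
  simpa using ge_of_tendsto' tendsto_sum le_sum

variable {E ι : Type*} [NormedAddCommGroup E] [InnerProductSpace ℝ E]

/-- The plane wave `ω ↦ e^{i k ⟨ω, x⟩}` on the unit sphere, as a function of the direction. -/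
noncomputable def planeWave (k : ℝ) (x : E) : C(sphere (0 : E) 1, ℂ) where
  toFun ω := cexp (I * k * (inner ℝ (ω : E) x : ℝ))

variable {e e' : E} {k : ℝ} {x : ι → E} {s : Finset ι} {v : ι → ℂ}

lemma sum_cexp_circle_eq_zero (he : ‖e‖ = 1) (he' : ‖e'‖ = 1) (hee' : inner ℝ e e' = 0)
    (hv : ∑ l ∈ s, v l • planeWave k (x l) = 0) (θ : ℂ) :
    ∑ l ∈ s, v l * cexp (I * k * (Complex.sin θ * (inner ℝ e (x l) : ℝ) +
      Complex.cos θ * (inner ℝ e' (x l) : ℝ))) = 0 := by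
  refine eq_zero_of_forall_ofReal (F := fun θ => ∑ l ∈ s, v l * cexp (I * k *
    (Complex.sin θ * (inner ℝ e (x l) : ℝ) + Complex.cos θ * (inner ℝ e' (x l) : ℝ))))
    (by fun_prop) (fun t => ?_) θ
  have norm_eq : ‖Real.sin t • e + Real.cos t • e'‖ = 1 := by
    rw [← sq_eq_sq₀ (norm_nonneg _) zero_le_one, norm_add_sq_real, inner_smul_left,
      inner_smul_right, hee', norm_smul, norm_smul, he, he']
    simp
  have := congrArg (· ⟨_, mem_sphere_zero_iff_norm.2 norm_eq⟩) hv
  simpa [planeWave, ContinuousMap.sum_apply, inner_add_left, inner_smul_left] using this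

/-- With `p = ⟨e, x⟩`, at these imaginary angles the wave of the point farthest in the direction
`e` dominates as `τ → ∞`. -/
lemma norm_cexp_circle (hk : k ≠ 0) (τ p q : ℝ) :
    ‖cexp (I * k * (Complex.sin (-(Real.arsinh (τ / k) * I)) * p +
      Complex.cos (-(Real.arsinh (τ / k) * I)) * q))‖ = Real.exp (τ * p) := by
  rw [Complex.cos_neg, Complex.sin_neg, Complex.cos_mul_I, Complex.sin_mul_I, ← ofReal_cosh,
    ← ofReal_sinh, Real.sinh_arsinh, norm_exp]
  congr 1
  simp only [mul_re, mul_im, add_re, add_im, neg_re, neg_im, I_re, I_im, ofReal_re, ofReal_im]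
  field_simp
  ring

theorem linearIndependent_planeWave (hE : 1 < finrank ℝ E) (hk : k ≠ 0)
    (hx : Function.Injective x) : LinearIndependent ℂ fun l => planeWave k (x l) := by
  classical
  obtain ⟨d, hd⟩ := Nat.exists_eq_add_of_lt hE
  refine linearIndependent_iff'.2 fun s v hv => ?_
  by_contra! hne
  obtain ⟨m, hm, hmax⟩ := (s.filter fun l => v l ≠ 0).exists_max_image (fun l => ‖x l‖)
    (by simpa [Finset.Nonempty] using hne)
  have hvm := (Finset.mem_filter.1 hm).2
  obtain ⟨b, hb⟩ := exists_orthonormalBasis_eq_norm_smul (d := d + 1) (by omega) (x m)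
  have inner_max : inner ℝ (b 0) (x m) = ‖x m‖ := by
    nth_rw 1 [hb]
    rw [inner_smul_right, real_inner_self_eq_norm_sq, b.norm_eq_one, one_pow, mul_one]
  have inner_lt (l) (hl : l ∈ s.filter fun l => v l ≠ 0) (hlm : l ≠ m) :
      inner ℝ (b 0) (x l) < inner ℝ (b 0) (x m) := by
    rw [inner_max]
    have inner_le : inner ℝ (b 0) (x l) ≤ ‖x l‖ := by
      simpa [b.norm_eq_one] using real_inner_le_norm (b 0) (x l)
    refine lt_of_le_of_ne (inner_le.trans (hmax l hl)) fun inner_eq => hlm (hx ?_)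
    have norm_eq : ‖x l‖ = ‖x m‖ := le_antisymm (hmax l hl) (inner_eq ▸ inner_le)
    have parallel := (inner_eq_norm_mul_iff_real (x := b 0) (y := x l)).1 <| by
      rw [inner_eq, b.norm_eq_one, one_mul, norm_eq]
    rw [b.norm_eq_one, one_smul] at parallel
    rw [← parallel, norm_eq, ← hb]
  have sum_filter_eq_zero : ∑ l ∈ s with v l ≠ 0, v l • planeWave k (x l) = 0 := by
    rw [← hv]
    exact Finset.sum_filter_of_ne fun l _ h₀ hvl =>
      h₀ (ContinuousMap.ext fun ω => by simp [hvl])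
  refine hvm (norm_eq_zero.1 ?_)
  refine eq_zero_of_sum_eq_zero_of_norm_eq_mul_exp hm (c := fun l => ‖v l‖)
    (fun l _ τ => ?_) (fun τ => sum_cexp_circle_eq_zero (b.norm_eq_one 0) (b.norm_eq_one 1)
      (b.orthonormal.2 (by simp)) sum_filter_eq_zero (-(Real.arsinh (τ / k) * I))) inner_lt
  rw [norm_mul, norm_cexp_circle hk]

theorem posDef_f_dist [MeasurableSpace E] [BorelSpace E] [Finite ι] (hE : finrank ℝ E = 3)
    (hk : k ≠ 0) (hx : Function.Injective x) :
    (Matrix.of fun j l => f k (dist (x j) (x l))).PosDef := by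
  have : FiniteDimensional ℝ E := .of_finrank_pos (hE ▸ Nat.succ_pos 2)
  let σ := (volume : Measure E).toSphere
  have linearIndependent := (linearIndependent_planeWave (hE ▸ (by norm_num)) hk hx).map'
    (ContinuousMap.toLp (E := ℂ) 2 σ ℂ).toLinearMap
    (LinearMap.ker_eq_bot.2 (ContinuousMap.toLp_injective σ))
  convert! Matrix.posDef_gram_of_linearIndependent linearIndependent using 1
  ext j l
  rw [Matrix.of_apply, Matrix.gram_apply, dist_comm, dist_eq_norm, f_norm_eq_integral_toSphere hE]
  refine Eq.trans (integral_congr_ae (.of_forall fun ω => ?_))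
    (ContinuousMap.inner_toLp (𝕜 := ℂ) σ (planeWave k (x j)) (planeWave k (x l))).symm
  simp only [planeWave, ContinuousMap.coe_mk, ← exp_conj, ← Complex.exp_add, map_mul, conj_I,
    conj_ofReal, inner_sub_right, ofReal_sub]
  ring_nf

end PlaneWaves

/-! ### Zeros counted with multiplicity -/

section ListsRoots

open Finset

variable {F G g : ℂ → ℂ} {S U : Set ℂ} {n : ℕ} {y : Fin n → ℂ} {a z : ℂ}

lemma listsRoots_of_order (hF : AnalyticOnNhd ℂ F S) (hy : ∀ j, y j ∈ S)
    (hord : ∀ z ∈ S, analyticOrderAt F z = #{j | y j = z}) : ListsRoots F S y := by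
  refine ⟨hF, hy, fun z hz => ⟨?_, hord z hz⟩⟩
  rw [← (hF z hz).analyticOrderAt_ne_zero, hord z hz]
  simp [filter_eq_empty_iff]

lemma ListsRoots.apply_eq_zero (hF : ListsRoots F S y) (j : Fin n) : F (y j) = 0 :=
  (hF.2.2 _ (hF.2.1 j)).1.2 ⟨j, rfl⟩

lemma ListsRoots.mono (hF : ListsRoots F U y) (hSU : S ⊆ U) (hy : ∀ j, y j ∈ S) :
    ListsRoots F S y :=
  ⟨hF.1.mono hSU, hy, fun z hz => hF.2.2 z (hSU hz)⟩

lemma ListsRoots.extend (hF : ListsRoots F S y) (hSU : S ⊆ U) (hU : AnalyticOnNhd ℂ F U)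
    (hne : ∀ z ∈ U, z ∉ S → F z ≠ 0) : ListsRoots F U y := by
  refine listsRoots_of_order hU (fun j => hSU (hF.2.1 j)) fun z hz => ?_
  by_cases hzS : z ∈ S
  · exact (hF.2.2 z hzS).2
  · have notMem_range : ∀ j, y j ≠ z := fun j hj => hzS (hj ▸ hF.2.1 j)
    simp [(hU z hz).analyticOrderAt_eq_zero.2 (hne z hz hzS), notMem_range]

lemma ListsRoots.congr (hF : ListsRoots F S y) (hS : IsOpen S) (hFG : Set.EqOn F G S) :
    ListsRoots G S y := by
  have eventuallyEq {z} (hz : z ∈ S) : F =ᶠ[𝓝 z] G := hFG.eventuallyEq_of_mem (hS.mem_nhds hz)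
  refine listsRoots_of_order (fun z hz => (hF.1 z hz).congr (eventuallyEq hz)) hF.2.1 fun z hz => ?_
  rw [← analyticOrderAt_congr (eventuallyEq hz), (hF.2.2 z hz).2]

lemma analyticOrderAt_sub_const_mul (hg : AnalyticAt ℂ g z) :
    analyticOrderAt (fun w => (w - a) * g w) z =
      (if a = z then 1 else 0) + analyticOrderAt g z := by
  refine (analyticOrderAt_mul (f := (· - a)) (by fun_prop) hg).trans ?_
  split_ifs with haz
  · rw [haz, analyticOrderAt_id_sub_const_self]
  · rw [analyticOrderAt_id_sub_const_of_ne (Ne.symm haz)]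

lemma sub_mul_dslope_of_eq_zero (ha : F a = 0) (w : ℂ) : (w - a) * dslope F a w = F w := by
  simpa [ha] using sub_smul_dslope F a w

lemma analyticOnNhd_dslope (hF : AnalyticOnNhd ℂ F S) (a : ℂ) : AnalyticOnNhd ℂ (dslope F a) S := by
  intro z hz
  rcases eq_or_ne z a with rfl | hza
  · obtain ⟨p, hp⟩ := hF z hz
    exact ⟨_, hp.has_fpower_series_dslope_fslope⟩
  · refine AnalyticAt.congr ?_ (dslope_eventuallyEq_slope_of_ne F hza).symm
    simp only [slope_fun_def, vsub_eq_sub, smul_eq_mul]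
    have := hF z hz
    fun_prop (disch := exact sub_ne_zero.2 hza)

theorem ListsRoots.exists_eq_prod_mul (hF : ListsRoots F S y) :
    ∃ g : ℂ → ℂ, AnalyticOnNhd ℂ g S ∧ (∀ z ∈ S, g z ≠ 0) ∧
      ∀ w, F w = (∏ j, (w - y j)) * g w := by
  induction n generalizing F with
  | zero => exact ⟨F, hF.1, fun z hz h₀ => ((hF.2.2 z hz).1.1 h₀).elim finZeroElim, by simp⟩
  | succ n ih =>
    have factor := sub_mul_dslope_of_eq_zero (hF.apply_eq_zero 0)
    have analytic := analyticOnNhd_dslope hF.1 (y 0)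
    have listsRoots_dslope : ListsRoots (dslope F (y 0)) S (Fin.tail y) := by
      refine listsRoots_of_order analytic (fun j => hF.2.1 j.succ) fun z hz => ?_
      have order_eq := (hF.2.2 z hz).2
      rw [Fin.card_filter_univ_succ, ← funext factor,
        analyticOrderAt_sub_const_mul (analytic z hz)] at order_eq
      split_ifs at order_eq
      · rw [Nat.cast_add_one, add_comm] at order_eq
        exact WithTop.add_right_cancel ENat.one_ne_top order_eq
      · rwa [zero_add] at order_eq
    obtain ⟨g, hg, hg₀, hFg⟩ := ih listsRoots_dslope
    refine ⟨g, hg, hg₀, fun w => ?_⟩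
    rw [← factor, hFg, Fin.prod_univ_succ, mul_assoc]
    rfl

lemma analyticOrderAt_prod_sub_mul (y : Fin n → ℂ) (hg : AnalyticAt ℂ g z) (hg₀ : g z ≠ 0) :
    analyticOrderAt (fun w => (∏ j, (w - y j)) * g w) z = #{j | y j = z} := by
  induction n with
  | zero => simp [hg.analyticOrderAt_eq_zero.2 hg₀]
  | succ n ih =>
    simp only [Fin.prod_univ_succ, mul_assoc]
    rw [analyticOrderAt_sub_const_mul (by fun_prop), ih, Fin.card_filter_univ_succ]
    split_ifs
    · rw [Nat.cast_add_one, add_comm]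
    · rw [zero_add]

theorem listsRoots_prod_mul (hy : ∀ j, y j ∈ S) (hg : AnalyticOnNhd ℂ g S)
    (hg₀ : ∀ z ∈ S, g z ≠ 0) : ListsRoots (fun w => (∏ j, (w - y j)) * g w) S y :=
  listsRoots_of_order (fun z hz => by have := hg z hz; fun_prop) hy
    fun z hz => analyticOrderAt_prod_sub_mul y (hg z hz) (hg₀ z hz)

theorem ListsRoots.conj (hF : ListsRoots F S y) :
    ListsRoots (fun z => (starRingEnd ℂ) (F ((starRingEnd ℂ) z))) (starRingEnd ℂ ⁻¹' S)
      fun j => (starRingEnd ℂ) (y j) := by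
  obtain ⟨g, hg, hg₀, hFg⟩ := hF.exists_eq_prod_mul
  have analytic_conj : AnalyticOnNhd ℂ (fun z => (starRingEnd ℂ) (g ((starRingEnd ℂ) z)))
      (starRingEnd ℂ ⁻¹' S) := fun z hz => by
    have := hg _ hz
    rw [analyticAt_iff_eventually_differentiableAt] at this ⊢
    filter_upwards [continuous_conj.continuousAt.eventually this] with w hw
    simpa [Function.comp_def] using hw.conj_conj
  simpa [hFg] using listsRoots_prod_mul (y := fun j => (starRingEnd ℂ) (y j))
    (fun j => by simpa using hF.2.1 j) analytic_conj (by simpa using fun z hz => hg₀ _ hz)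

theorem exists_listsRoots (hS : IsCompact S) (hS' : IsConnected S) (hF : AnalyticOnNhd ℂ F S)
    {z₁ : ℂ} (hz₁ : z₁ ∈ S) (hFz₁ : F z₁ ≠ 0) : ∃ (n : ℕ) (y : Fin n → ℂ), ListsRoots F S y := by
  have order_ne_top {z} (hz : z ∈ S) : analyticOrderAt F z ≠ ⊤ := by
    refine hF.analyticOrderAt_ne_top_of_isPreconnected hS'.isPreconnected hz₁ hz ?_
    simp [(hF z₁ hz₁).analyticOrderAt_eq_zero.2 hFz₁]
  have finite_zeros : (Function.support (S.indicator (analyticOrderNatAt F))).Finite := by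
    refine (hS.finite_sdiff_of_mem_codiscreteWithin
      (hF.preimage_zero_mem_codiscreteWithin hFz₁ hz₁ hS')).subset fun z hz => ?_
    rw [Set.support_indicator] at hz
    exact ⟨hz.1, by simpa using apply_eq_zero_of_analyticOrderNatAt_ne_zero hz.2⟩
  let zeros := (Finsupp.ofSupportFinite _ finite_zeros).toMultiset.toList
  have hy (z : ℂ) : #{j | zeros.get j = z} = S.indicator (analyticOrderNatAt F) z := by
    refine (Fin.card_filter_univ_eq_vector_get_eq_count z ⟨zeros, rfl⟩).trans ?_
    rw [List.Vector.toList_mk, ← Multiset.coe_count, Multiset.coe_toList,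
      Finsupp.count_toMultiset, Finsupp.ofSupportFinite_coe]
  refine ⟨_, zeros.get, listsRoots_of_order hF (fun j => ?_) fun z hz => ?_⟩
  · by_contra hj
    have := hy (zeros.get j)
    rw [Set.indicator_of_notMem hj, card_eq_zero, filter_eq_empty_iff] at this
    exact this (mem_univ j) rfl
  · rw [hy, Set.indicator_of_mem hz, Nat.cast_analyticOrderNatAt (order_ne_top hz)]

end ListsRoots

section Rouche

open Finset Metric

variable {F G : ℂ → ℂ} {c : ℂ} {r : ℝ} {n : ℕ} {y : Fin n → ℂ}

lemma continuousOn_logDeriv {S : Set ℂ} (hF : AnalyticOnNhd ℂ F S) (hF₀ : ∀ z ∈ S, F z ≠ 0) :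
    ContinuousOn (logDeriv F) S := fun z hz =>
  ((hF z hz).deriv.div (hF z hz) (hF₀ z hz)).continuousAt.continuousWithinAt

lemma circleIntegrable_sub_inv {w : ℂ} (hr : 0 ≤ r) (hw : w ∉ sphere c r) :
    CircleIntegrable (fun z => (z - w)⁻¹) c r := by
  rw [circleIntegrable_sub_inv_iff, abs_of_nonneg hr]
  exact Or.inr hw

theorem circleIntegral_logDeriv_eq_zero (hr : 0 ≤ r) (hF : AnalyticOnNhd ℂ F (closedBall c r))
    (hF₀ : ∀ z ∈ closedBall c r, F z ≠ 0) : ∮ z in C(c, r), logDeriv F z = 0 := by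
  refine circleIntegral_eq_zero_of_differentiable_on_off_countable hr Set.countable_empty
    (continuousOn_logDeriv hF hF₀) fun z hz => ?_
  have hz' := ball_subset_closedBall hz.1
  exact ((hF z hz').deriv.div (hF z hz') (hF₀ z hz')).differentiableAt

theorem ListsRoots.circleIntegral_logDeriv (hr : 0 ≤ r) (hF : ListsRoots F (closedBall c r) y)
    (hF₀ : ∀ z ∈ sphere c r, F z ≠ 0) :
    ∮ z in C(c, r), logDeriv F z = n * (2 * Real.pi * I) := by
  obtain ⟨g, hg, hg₀, hFg⟩ := hF.exists_eq_prod_mul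
  have notMem_sphere (j) : y j ∉ sphere c r := fun hj => hF₀ _ hj (hF.apply_eq_zero j)
  have mem_ball (j) : y j ∈ ball c r := by
    rw [← closedBall_sdiff_sphere]
    exact ⟨hF.2.1 j, notMem_sphere j⟩
  have logDeriv_eq {z} (hz : z ∈ sphere c r) :
      logDeriv F z = ∑ j, (z - y j)⁻¹ + logDeriv g z := by
    have hz' := sphere_subset_closedBall hz
    have sub_ne (j) : z - y j ≠ 0 := sub_ne_zero.2 fun h => notMem_sphere j (h ▸ hz)
    rw [funext hFg, logDeriv_mul z (prod_ne_zero_iff.2 fun j _ => sub_ne j) (hg₀ z hz')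
      (by fun_prop) (hg z hz').differentiableAt, logDeriv_prod (fun j _ => sub_ne j)
      (fun j _ => by fun_prop)]
    simp [logDeriv_apply]
  have integrable (j) : CircleIntegrable (fun z => (z - y j)⁻¹) c r :=
    circleIntegrable_sub_inv hr (notMem_sphere j)
  rw [circleIntegral.integral_congr hr fun z hz => logDeriv_eq hz, circleIntegral.integral_add
    (CircleIntegrable.fun_sum _ fun j _ => integrable j)
    (((continuousOn_logDeriv hg hg₀).mono sphere_subset_closedBall).circleIntegrable hr),
    circleIntegral.integral_fun_sum fun j _ => integrable j,
    circleIntegral_logDeriv_eq_zero hr hg hg₀, add_zero]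
  simp [circleIntegral.integral_sub_inv_of_mem_ball (mem_ball _)]

lemma circleIntegral_logDeriv_eq_of_norm_sub_lt (hr : 0 ≤ r)
    (hF : AnalyticOnNhd ℂ F (sphere c r)) (hG : AnalyticOnNhd ℂ G (sphere c r))
    (hFG : ∀ z ∈ sphere c r, ‖F z - G z‖ < ‖G z‖) :
    ∮ z in C(c, r), logDeriv F z = ∮ z in C(c, r), logDeriv G z := by
  have G_ne_zero {z} (hz : z ∈ sphere c r) : G z ≠ 0 :=
    norm_pos_iff.1 ((norm_nonneg _).trans_lt (hFG z hz))
  have div_mem_slitPlane {z} (hz : z ∈ sphere c r) : F z / G z ∈ slitPlane := by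
    have norm_lt : ‖F z / G z - 1‖ < 1 := by
      rw [div_sub_one (G_ne_zero hz), norm_div, div_lt_one (norm_pos_iff.2 (G_ne_zero hz))]
      exact hFG z hz
    simpa using mem_slitPlane_of_norm_lt_one norm_lt
  have F_ne_zero {z} (hz : z ∈ sphere c r) : F z ≠ 0 := fun h₀ =>
    slitPlane_ne_zero (div_mem_slitPlane hz) (by rw [h₀, zero_div])
  rw [← sub_eq_zero, ← circleIntegral.integral_sub
    ((continuousOn_logDeriv hF fun z => F_ne_zero).circleIntegrable hr)
    ((continuousOn_logDeriv hG fun z => G_ne_zero).circleIntegrable hr)]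
  refine circleIntegral.integral_eq_zero_of_hasDerivWithinAt hr
    (f := fun z => log (F z / G z)) fun z hz => ?_
  have hFz := (hF z hz).differentiableAt
  have hGz := (hG z hz).differentiableAt
  rw [← logDeriv_div z (F_ne_zero hz) (G_ne_zero hz) hFz hGz]
  exact ((hFz.div hGz (G_ne_zero hz)).hasDerivAt.clog (div_mem_slitPlane hz)).hasDerivWithinAt

theorem ListsRoots.rouche (hr : 0 < r) (hG : ListsRoots G (closedBall c r) y)
    (hF : AnalyticOnNhd ℂ F (closedBall c r)) (hFG : ∀ z ∈ sphere c r, ‖F z - G z‖ < ‖G z‖) :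
    ∃ y' : Fin n → ℂ, ListsRoots F (closedBall c r) y' := by
  have F_ne_zero (z) (hz : z ∈ sphere c r) : F z ≠ 0 := fun h₀ => by
    simpa [h₀] using hFG z hz
  have G_ne_zero (z) (hz : z ∈ sphere c r) : G z ≠ 0 :=
    norm_pos_iff.1 ((norm_nonneg _).trans_lt (hFG z hz))
  obtain ⟨z₁, hz₁⟩ := (NormedSpace.sphere_nonempty (E := ℂ) (x := c)).2 hr.le
  obtain ⟨m, y', hy'⟩ := exists_listsRoots (isCompact_closedBall c r)
    ((convex_closedBall c r).isConnected (nonempty_closedBall.2 hr.le)) hF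
    (sphere_subset_closedBall hz₁) (F_ne_zero z₁ hz₁)
  have count_eq := circleIntegral_logDeriv_eq_of_norm_sub_lt hr.le
    (hF.mono sphere_subset_closedBall) (hG.1.mono sphere_subset_closedBall) hFG
  rw [hy'.circleIntegral_logDeriv hr.le F_ne_zero, hG.circleIntegral_logDeriv hr.le G_ne_zero,
    mul_left_inj' two_pi_I_ne_zero, Nat.cast_inj] at count_eq
  subst count_eq
  exact ⟨y', hy'⟩

end Rouche

/-! ### Strictly dissipative matrices -/

section Dissipative

open Matrix
open scoped ComplexOrder

variable {ι : Type*} [Fintype ι] {M P : Matrix ι ι ℂ} {a ε : ℝ} {v : ι → ℂ} {w : ℂ}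

/-- A complex matrix whose quadratic form takes nonzero vectors to the open lower half-plane. -/
def IsStrictlyDissipative (M : Matrix ι ι ℂ) : Prop :=
  ∀ v ≠ 0, (star v ⬝ᵥ M *ᵥ v).im < 0

lemma isStrictlyDissipative_of_sub_conjTranspose (ha : 0 < a) (hP : P.PosDef)
    (hM : M - Mᴴ = (-(a * I)) • P) : IsStrictlyDissipative M := fun v hv => by
  have conj_form : star v ⬝ᵥ Mᴴ *ᵥ v = (starRingEnd ℂ) (star v ⬝ᵥ M *ᵥ v) := by
    rw [starRingEnd_apply, ← star_dotProduct_star, star_star, star_mulVec,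
      dotProduct_mulVec]
  have form_eq := congrArg (fun A => star v ⬝ᵥ A *ᵥ v) hM
  simp only [sub_mulVec, dotProduct_sub, conj_form, sub_conj, smul_mulVec, dotProduct_smul,
    smul_eq_mul] at form_eq
  have im_eq := congrArg im form_eq
  simp only [im_ofReal_mul, I_im, mul_one, neg_mul, mul_assoc, neg_im, I_mul_im] at im_eq
  have := mul_pos ha (Complex.pos_iff.1 (hP.dotProduct_mulVec_pos hv)).1
  linarith

lemma isOpen_setOf_isStrictlyDissipative :
    IsOpen {M : Matrix ι ι ℂ | IsStrictlyDissipative M} := by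
  refine isOpen_iff_eventually.2 fun M₀ hM₀ => ?_
  have eventually_sphere : ∀ᶠ M : Matrix ι ι ℂ in 𝓝 M₀, ∀ v ∈ Metric.sphere (0 : ι → ℂ) 1,
      (star v ⬝ᵥ M *ᵥ v).im < 0 := by
    refine (isCompact_sphere _ _).eventually_forall_of_forall_eventually fun v hv => ?_
    have continuous_form : Continuous fun p : Matrix ι ι ℂ × (ι → ℂ) =>
        (star p.2 ⬝ᵥ p.1 *ᵥ p.2).im := by
      fun_prop
    exact continuous_form.continuousAt.eventually_lt_const
      (hM₀ v (Metric.ne_of_mem_sphere hv one_ne_zero))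
  filter_upwards [eventually_sphere] with M hM v hv
  have norm_pos : 0 < ‖v‖ := norm_pos_iff.2 hv
  have unit_neg := hM (((‖v‖⁻¹ : ℝ) : ℂ) • v) (by simp [norm_smul, norm_pos.ne'])
  simp only [mulVec_smul, star_smul, smul_dotProduct, dotProduct_smul, smul_eq_mul,
    star_def, conj_ofReal, im_ofReal_mul] at unit_neg
  have inv_pos := inv_pos.2 norm_pos
  exact neg_of_mul_neg_right (neg_of_mul_neg_right unit_neg inv_pos.le) inv_pos.le

lemma im_pos_of_det_smul_one_add_smul_eq_zero [DecidableEq ι] (hM : IsStrictlyDissipative M)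
    (hε : 0 < ε) (hw : (w • 1 + (ε : ℂ) • M).det = 0) : 0 < w.im := by
  obtain ⟨v, hv, kernel⟩ := exists_mulVec_eq_zero_iff.2 hw
  obtain ⟨norm_re, norm_im⟩ := Complex.pos_iff.1 (dotProduct_star_self_pos_iff.2 hv)
  have form_eq := congrArg (fun u => (star v ⬝ᵥ u).im) kernel
  simp only [add_mulVec, smul_mulVec, one_mulVec, dotProduct_add, dotProduct_smul, smul_eq_mul,
    dotProduct_zero, add_im, mul_im, zero_im, ofReal_im, ofReal_re, ← norm_im, mul_zero,
    zero_mul, zero_add, add_zero] at form_eq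
  refine pos_of_mul_pos_left ?_ norm_re.le
  linarith [mul_neg_of_pos_of_neg hε (hM v hv)]

end Dissipative

/-! ### Perturbation of the determinant -/

section Perturbation

variable {ι : Type*} [Fintype ι] [DecidableEq ι]

lemma exists_norm_det_one_add_sub_one_lt :
    ∃ δ > 0, ∀ B : Matrix ι ι ℂ, (∀ i j, ‖B i j‖ < δ) → ‖(1 + B).det - 1‖ < 1 := by
  have continuous_det : Continuous fun B : ι → ι → ℂ => (1 + Matrix.of B).det :=
    (continuous_const.add continuous_id).matrix_det
  obtain ⟨δ, hδ, close⟩ := Metric.continuousAt_iff.1 (continuous_det.continuousAt (x := 0)) 1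
    one_pos
  refine ⟨δ, hδ, fun B hB => ?_⟩
  have := close (x := B) ((dist_pi_lt_iff hδ).2 fun i => (dist_pi_lt_iff hδ).2 fun j => by
    simpa using hB i j)
  rwa [dist_eq, Matrix.of_zero, add_zero, Matrix.det_one] at this

lemma exists_norm_det_smul_one_add_sub_pow_lt :
    ∃ δ > 0, ∀ (w : ℂ) (B : Matrix ι ι ℂ), w ≠ 0 → (∀ i j, ‖B i j‖ < δ * ‖w‖) →
      ‖(w • 1 + B).det - w ^ Fintype.card ι‖ < ‖w ^ Fintype.card ι‖ := by
  obtain ⟨δ, hδ, near_one⟩ := exists_norm_det_one_add_sub_one_lt (ι := ι)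
  refine ⟨δ, hδ, fun w B hw hB => ?_⟩
  have factor : w • 1 + B = w • (1 + w⁻¹ • B) := by rw [smul_add, smul_inv_smul₀ hw]
  have pow_pos : 0 < ‖w ^ Fintype.card ι‖ := norm_pos_iff.2 (pow_ne_zero _ hw)
  rw [factor, Matrix.det_smul, ← mul_sub_one, norm_mul]
  refine mul_lt_of_lt_one_right pow_pos (near_one _ fun i j => ?_)
  rw [Matrix.smul_apply, smul_eq_mul, norm_mul, norm_inv, inv_mul_lt_iff₀' (norm_pos_iff.2 hw)]
  exact hB i j

variable {N : ℕ} {Ω c g r M : ℝ} {A : ℂ → Matrix (Fin N) (Fin N) ℂ} {U : Set ℂ}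

lemma analyticOnNhd_resDet (hU : IsOpen U) (hA : ∀ j l, DifferentiableOn ℂ (A · j l) U) :
    AnalyticOnNhd ℂ (resDet Ω c g A) U := by
  refine DifferentiableOn.analyticOnNhd ?_ hU
  unfold resDet
  simp only [Matrix.det_apply, Matrix.add_apply, Matrix.smul_apply, smul_eq_mul]
  fun_prop

theorem eventually_exists_listsRoots_resDet (hr : 0 < r) (hU : IsOpen U)
    (hrU : Metric.closedBall (Ω : ℂ) r ⊆ U) (hA : ∀ j l, DifferentiableOn ℂ (A · j l) U)
    (hAM : ∀ z ∈ U, ∀ j l, ‖A z j l‖ ≤ M) :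
    ∀ᶠ g : ℝ in 𝓝 0, ∃ y : Fin N → ℂ,
      (∀ j, y j ∈ Metric.ball (Ω : ℂ) r) ∧ ListsRoots (resDet Ω c g A) U y := by
  obtain ⟨δ, hδ, near_pow⟩ := exists_norm_det_smul_one_add_sub_pow_lt (ι := Fin N)
  have eventually_small :
      ∀ᶠ g : ℝ in 𝓝 0, |g ^ 2 / ((2 * Real.pi) ^ 3 * c)| * M < δ * r :=
    (Continuous.tendsto' (by fun_prop) 0 0 (by simp)).eventually_lt_const (mul_pos hδ hr)
  filter_upwards [eventually_small] with g small
  have far {z : ℂ} (hz : z ∈ U) (hrz : r ≤ dist z Ω) :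
      ‖resDet Ω c g A z - (z - Ω) ^ N‖ < ‖(z - Ω) ^ N‖ := by
    rw [dist_eq] at hrz
    have := near_pow (z - Ω) (((g ^ 2 / ((2 * Real.pi) ^ 3 * c) : ℝ) : ℂ) • A z)
      (norm_pos_iff.1 (hr.trans_le hrz)) fun i j => by
        rw [Matrix.smul_apply, norm_smul, norm_real, Real.norm_eq_abs]
        exact (mul_le_mul_of_nonneg_left (hAM z hz i j) (abs_nonneg _)).trans_lt
          (small.trans_le (by gcongr))
    rwa [Fintype.card_fin] at this
  have ne_zero {z : ℂ} (hz : z ∈ U) (hrz : r ≤ dist z Ω) : resDet Ω c g A z ≠ 0 := fun h₀ => by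
    simpa [h₀] using far hz hrz
  have analytic := analyticOnNhd_resDet (Ω := Ω) (c := c) (g := g) hU hA
  have listsRoots_pow :
      ListsRoots (fun z => (z - Ω) ^ N) (Metric.closedBall (Ω : ℂ) r) fun _ : Fin N => (Ω : ℂ) := by
    simpa using listsRoots_prod_mul (y := fun _ : Fin N => (Ω : ℂ)) (g := fun _ => 1)
      (fun _ => Metric.mem_closedBall_self hr.le) analyticOnNhd_const (by simp)
  obtain ⟨y, hy⟩ := listsRoots_pow.rouche hr (analytic.mono hrU) fun z hz =>
    far (hrU (Metric.sphere_subset_closedBall hz)) (Metric.mem_sphere.1 hz).ge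
  exact ⟨y, fun j => not_le.1 fun hj => ne_zero (hrU (hy.2.1 j)) hj (hy.apply_eq_zero j),
    hy.extend hrU analytic fun z hz hzr => ne_zero hz (not_le.1 hzr).le⟩

end Perturbation

/-! ### The interaction matrices -/

section Numerator

variable {R r : ℝ} {k : ℂ}

/-- The numerator `e^{-k²R²} k² f(k,r)` of the Cauchy integral `Gam`. -/
noncomputable def numer (R r : ℝ) (k : ℂ) : ℂ :=
  cexp (-(k ^ 2 * R ^ 2)) * (k ^ 2 * f k r)

lemma f_eq_dslope_sin (k : ℂ) (r : ℝ) : f k r = 4 * Real.pi * dslope sin 0 (k * r) := by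
  rw [f]
  split_ifs with h₀
  · rw [h₀, dslope_same, Complex.deriv_sin, Complex.cos_zero, mul_one]
  · rw [dslope_of_ne _ h₀, slope_def_field, Complex.sin_zero, sub_zero, sub_zero, mul_div_assoc]

lemma differentiable_numer (R r : ℝ) : Differentiable ℂ (numer R r) := by
  have differentiable_dslope : Differentiable ℂ (dslope sin 0) := by
    rw [← differentiableOn_univ]
    exact (differentiableOn_dslope univ_mem).2 differentiable_sin.differentiableOn
  have := differentiable_dslope.comp (differentiable_id.mul_const (r : ℂ))
  simp only [Function.comp_def, id] at this
  unfold numer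
  simp only [f_eq_dslope_sin]
  fun_prop

lemma f_conj (k : ℂ) (r : ℝ) : f ((starRingEnd ℂ) k) r = (starRingEnd ℂ) (f k r) := by
  have : (starRingEnd ℂ) k * (r : ℂ) = (starRingEnd ℂ) (k * r) := by simp
  rw [f, f, this, Complex.sin_conj]
  simp only [map_eq_zero]
  split_ifs <;> simp [Complex.conj_ofNat]

lemma numer_conj (R r : ℝ) (k : ℂ) :
    numer R r ((starRingEnd ℂ) k) = (starRingEnd ℂ) (numer R r k) := by
  simp only [numer, f_conj, map_mul, map_pow, ← exp_conj, map_neg, conj_ofReal]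

lemma norm_f_le (k : ℂ) (r : ℝ) : ‖f k r‖ ≤ 4 * Real.pi * Real.exp (|r| * ‖k‖) := by
  have norm_integral_le : ‖∫ s in (-1 : ℝ)..1, cexp (I * k * (s * r : ℝ))‖ ≤
      Real.exp (|r| * ‖k‖) * |1 - (-1)| := by
    refine intervalIntegral.norm_integral_le_of_norm_le_const fun s hs => ?_
    rw [Set.uIoc_of_le (by norm_num)] at hs
    have abs_s_le : |s| ≤ 1 := abs_le.2 ⟨hs.1.le, hs.2⟩
    refine (norm_exp_le_exp_norm _).trans (Real.exp_le_exp.2 ?_)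
    rw [norm_mul, norm_mul, norm_I, one_mul, norm_real, Real.norm_eq_abs, abs_mul, mul_comm ‖k‖]
    gcongr
    exact mul_le_of_le_one_left (abs_nonneg r) abs_s_le
  rw [f_eq_integral_cexp, norm_mul, norm_mul, norm_real, Real.norm_of_nonneg Real.pi_pos.le,
    RCLike.norm_ofNat]
  norm_num at norm_integral_le ⊢
  nlinarith [Real.pi_pos]

lemma mul_sq_norm_le_re_sq (hk : k ∈ wedge) : 7 / 25 * ‖k‖ ^ 2 ≤ (k ^ 2).re := by
  obtain ⟨him, hle⟩ := mem_wedge.1 hk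
  rw [Complex.sq_norm, normSq_apply, sq k, mul_re]
  nlinarith [re_nonneg_of_mem_wedge hk]

lemma norm_gaussian_le (R : ℝ) (hk : k ∈ wedge) :
    ‖cexp (-(k ^ 2 * R ^ 2))‖ ≤ Real.exp (-(7 / 25 * R ^ 2 * ‖k‖ ^ 2)) := by
  rw [norm_exp, Real.exp_le_exp, neg_re, neg_le_neg_iff, ← ofReal_pow, re_mul_ofReal,
    mul_right_comm]
  gcongr
  exact mul_sq_norm_le_re_sq hk

lemma mul_sub_mul_sq_le {a : ℝ} (ha : 0 < a) (b s : ℝ) : b * s - a * s ^ 2 ≤ b ^ 2 / (4 * a) := by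
  rw [le_div_iff₀ (by positivity)]
  nlinarith [sq_nonneg (2 * a * s - b)]

lemma exists_norm_numer_le (hR : R ≠ 0) (r : ℝ) :
    ∃ C, ∀ k ∈ wedge, ‖numer R r k‖ ≤ C * ‖k‖ * Real.exp (-‖k‖) := by
  set a : ℝ := 7 / 25 * R ^ 2
  have ha₀ : 0 < a := by positivity
  refine ⟨4 * Real.pi * Real.exp ((|r| + 2) ^ 2 / (4 * a)), fun k hk => ?_⟩
  have norm_le_exp : ‖k‖ ≤ Real.exp ‖k‖ := by linarith [Real.add_one_le_exp ‖k‖]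
  have exponent_le : -(a * ‖k‖ ^ 2) + ‖k‖ + |r| * ‖k‖ ≤ (|r| + 2) ^ 2 / (4 * a) + -‖k‖ := by
    linarith [mul_sub_mul_sq_le ha₀ (|r| + 2) ‖k‖]
  calc ‖numer R r k‖ = ‖cexp (-(k ^ 2 * R ^ 2))‖ * (‖k‖ * ‖k‖ * ‖f k r‖) := by
        rw [numer, norm_mul, norm_mul, norm_pow, sq ‖k‖]
    _ ≤ Real.exp (-(a * ‖k‖ ^ 2)) *
        (‖k‖ * Real.exp ‖k‖ * (4 * Real.pi * Real.exp (|r| * ‖k‖))) := by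
        gcongr
        · exact norm_gaussian_le R hk
        · exact norm_f_le k r
    _ = 4 * Real.pi * ‖k‖ * Real.exp (-(a * ‖k‖ ^ 2) + ‖k‖ + |r| * ‖k‖) := by
        rw [Real.exp_add, Real.exp_add]
        ring
    _ ≤ 4 * Real.pi * ‖k‖ * Real.exp ((|r| + 2) ^ 2 / (4 * a) + -‖k‖) := by
        gcongr
    _ = _ := by
        rw [Real.exp_add]
        ring

end Numerator

section BoundaryValues

variable {h : ℂ → ℂ} {z k : ℂ} {C : ℝ}

lemma convex_openSector : Convex ℝ openSector := by
  refine convex_iff_forall_pos.2 fun z hz w hw a b ha hb _ => ?_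
  simp only [openSector, Set.mem_ofPred_eq, abs_lt, add_re, add_im, smul_re, smul_im,
    smul_eq_mul] at *
  constructor <;> nlinarith

lemma norm_mul_norm_le (hhC : ∀ k ∈ wedge, ‖h k‖ ≤ C * ‖k‖ * Real.exp (-‖k‖)) (hk : k ∈ wedge) :
    ‖h k‖ * ‖k‖ ≤ 2 * C := by
  have sq_mul_exp_le : ‖k‖ ^ 2 * Real.exp (-‖k‖) ≤ 2 := by
    rw [Real.exp_neg, ← div_eq_mul_inv, div_le_iff₀ (Real.exp_pos _)]
    linarith [Real.quadratic_le_exp_of_nonneg (norm_nonneg k), norm_nonneg k]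
  calc ‖h k‖ * ‖k‖ ≤ C * ‖k‖ * Real.exp (-‖k‖) * ‖k‖ := by
        gcongr
        exact hhC k hk
    _ = C * (‖k‖ ^ 2 * Real.exp (-‖k‖)) := by ring
    _ ≤ C * 2 := by
        gcongr
        exact nonneg_of_norm_le_mul_exp hhC
    _ = 2 * C := mul_comm _ _

lemma rayCauchy_one_conj (hh : ∀ k, h ((starRingEnd ℂ) k) = (starRingEnd ℂ) (h k)) (z : ℂ) :
    rayCauchy 1 h ((starRingEnd ℂ) z) = (starRingEnd ℂ) (rayCauchy 1 h z) := by
  simp only [rayCauchy, rayIntegral, one_mul]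
  rw [← integral_conj]
  congr 1 with t
  rw [map_div₀, map_sub, conj_ofReal, ← hh, conj_ofReal]

theorem conj_rayCauchy_ray_conj (hh : Differentiable ℂ h)
    (hhC : ∀ k ∈ wedge, ‖h k‖ ≤ C * ‖k‖ * Real.exp (-‖k‖))
    (hconj : ∀ k, h ((starRingEnd ℂ) k) = (starRingEnd ℂ) (h k)) (hz : z ∈ openSector) :
    (starRingEnd ℂ) (rayCauchy ray h ((starRingEnd ℂ) z)) =
      rayCauchy ray h z + 2 * Real.pi * I * h z := by
  have differentiable := differentiableOn_rayCauchy hh hhC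
  have analytic_left : AnalyticOnNhd ℂ
      (fun z => (starRingEnd ℂ) (rayCauchy ray h ((starRingEnd ℂ) z))) openSector := by
    refine DifferentiableOn.analyticOnNhd (fun w hw => ?_) isOpen_openSector
    have := differentiable.differentiableAt (isOpen_openSector.mem_nhds (conj_mem_openSector hw))
    simpa [Function.comp_def] using this.conj_conj.differentiableWithinAt
  have analytic_right : AnalyticOnNhd ℂ
      (fun z => rayCauchy ray h z + 2 * Real.pi * I * h z) openSector :=
    (differentiable.add (by fun_prop)).analyticOnNhd isOpen_openSector
  have mem : (⟨2, 1⟩ : ℂ) ∈ openSector := by norm_num [openSector]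
  have eventually_upper : ∀ᶠ w in 𝓝 (⟨2, 1⟩ : ℂ), w ∈ openSector ∧ 0 < w.im :=
    (isOpen_openSector.inter (isOpen_lt continuous_const continuous_im)).mem_nhds
      ⟨mem, show (0 : ℝ) < 1 from one_pos⟩
  refine analytic_left.eqOn_of_preconnected_of_eventuallyEq analytic_right
    convex_openSector.isPreconnected mem ?_ hz
  filter_upwards [eventually_upper] with w ⟨hw, him⟩
  rw [← rayCauchy_one_of_im_neg hh (fun k => norm_mul_norm_le hhC) (conj_mem_openSector hw)
    (by simpa using him), ← rayCauchy_one_of_im_pos hh (fun k => norm_mul_norm_le hhC) hw him,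
    rayCauchy_one_conj hconj, conj_conj]

end BoundaryValues

section Continuation

variable {c R r : ℝ} {y z : ℂ}

lemma I_mul_Gam (hc : c ≠ 0) (R r : ℝ) (y : ℂ) :
    I * c * Gam c R r (-I * y) = rayCauchy 1 (numer R r) (y / c) := by
  have hc₀ : (c : ℂ) ≠ 0 := ofReal_ne_zero.2 hc
  rw [Gam, ← mul_assoc, mul_one_div_cancel (mul_ne_zero I_ne_zero hc₀), one_mul]
  simp only [rayCauchy, rayIntegral, one_mul]
  congr 1 with t
  have denom_eq : -I * y / (I * c) + t = t - y / c := by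
    field_simp [I_ne_zero]
    ring
  rw [denom_eq, numer]
  push_cast
  ring

lemma jump_eq (c R r : ℝ) (y : ℂ) : jump c R r y = 2 * Real.pi * I * numer R r (y / c) := by
  rw [jump, numer, div_pow, show y ^ 2 * (R : ℂ) ^ 2 / c ^ 2 = y ^ 2 / c ^ 2 * R ^ 2 by ring]
  ring

lemma continuous_jump (c R r : ℝ) : Continuous (jump c R r) := by
  have := (differentiable_numer R r).continuous
  simp only [funext (jump_eq c R r)]
  fun_prop

lemma div_mem_openSector (hc : 0 < c) (hy : y ∈ openSector) : y / c ∈ openSector := by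
  change |(y / c).im| < 2 / 3 * (y / c).re
  rw [div_ofReal_im, div_ofReal_re, abs_div, abs_of_pos hc, ← mul_div_assoc]
  exact div_lt_div_of_pos_right hy hc

lemma differentiableOn_rayCauchy_numer (hc : 0 < c) (hR : R ≠ 0) (r : ℝ) :
    DifferentiableOn ℂ (fun y => rayCauchy ray (numer R r) (y / c)) openSector := by
  obtain ⟨C, hC⟩ := exists_norm_numer_le hR r
  exact (differentiableOn_rayCauchy (differentiable_numer R r) hC).comp (by fun_prop)
    fun y hy => div_mem_openSector hc hy

lemma continuousAt_rayCauchy_numer (hc : 0 < c) (hR : R ≠ 0) (r : ℝ) (hy : y ∈ openSector) :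
    ContinuousAt (fun y => rayCauchy ray (numer R r) (y / c)) y :=
  ((differentiableOn_rayCauchy_numer hc hR r).continuousOn).continuousAt
    (isOpen_openSector.mem_nhds hy)

lemma I_mul_Gam_of_im_neg (hc : 0 < c) (hR : R ≠ 0) (hy : y ∈ openSector) (him : y.im < 0) :
    I * c * Gam c R r (-I * y) = rayCauchy ray (numer R r) (y / c) := by
  obtain ⟨C, hC⟩ := exists_norm_numer_le hR r
  rw [I_mul_Gam hc.ne', rayCauchy_one_of_im_neg (differentiable_numer R r)
    (fun k => norm_mul_norm_le hC) (div_mem_openSector hc hy)]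
  rw [div_ofReal_im]
  exact div_neg_of_neg_of_pos him hc

lemma I_mul_Gam_of_im_pos (hc : 0 < c) (hR : R ≠ 0) (hy : y ∈ openSector) (him : 0 < y.im) :
    I * c * Gam c R r (-I * y) = rayCauchy ray (numer R r) (y / c) + jump c R r y := by
  obtain ⟨C, hC⟩ := exists_norm_numer_le hR r
  rw [I_mul_Gam hc.ne', jump_eq, rayCauchy_one_of_im_pos (differentiable_numer R r)
    (fun k => norm_mul_norm_le hC) (div_mem_openSector hc hy)]
  rw [div_ofReal_im]
  exact div_pos him hc

lemma limUnder_nhdsGT_zero_eq {E : Type*} [TopologicalSpace E] [T2Space E] [Nonempty E]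
    {F : ℂ → E} {G : ℝ → E} {d : ℂ} (hF : ContinuousAt F z)
    (hG : ∀ᶠ ε : ℝ in 𝓝[>] 0, G ε = F (z + ε * d)) : limUnder (𝓝[>] 0) G = F z := by
  have tendsto_add_mul : Tendsto (fun ε : ℝ => z + ε * d) (𝓝[>] 0) (𝓝 z) :=
    (Continuous.tendsto' (by fun_prop) 0 z (by simp)).mono_left nhdsWithin_le_nhds
  exact ((hF.tendsto.comp tendsto_add_mul).congr' (hG.mono fun _ h => h.symm)).limUnder_eq

lemma eventually_add_mul_mem_openSector (hz : z ∈ openSector) (d : ℂ) :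
    ∀ᶠ ε : ℝ in 𝓝[>] 0, z + ε * d ∈ openSector :=
  ((Continuous.tendsto' (by fun_prop) 0 z (by simp)).mono_left nhdsWithin_le_nhds).eventually_mem
    (isOpen_openSector.mem_nhds hz)

theorem Aplus_eq_rayCauchy (hc : 0 < c) (hR : R ≠ 0) (hy : y ∈ openSector) :
    Aplus c R r y = rayCauchy ray (numer R r) (y / c) := by
  rw [Aplus]
  split_ifs with hneg hpos
  · exact I_mul_Gam_of_im_neg hc hR hy hneg
  · rw [I_mul_Gam_of_im_pos hc hR hy hpos, add_sub_cancel_right]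
  · refine limUnder_nhdsGT_zero_eq (d := -I)
      (F := fun y => rayCauchy ray (numer R r) (y / c)) (continuousAt_rayCauchy_numer hc hR r hy) ?_
    filter_upwards [eventually_add_mul_mem_openSector hy (-I), self_mem_nhdsWithin] with ε mem hε
    rw [← I_mul_Gam_of_im_neg hc hR mem]
    · congr 2
      linear_combination -(ε : ℂ) * I_sq
    · simpa [le_antisymm (not_lt.1 hpos) (not_lt.1 hneg)] using hε

theorem Aminus_eq_Aplus_add_jump (hc : 0 < c) (hR : R ≠ 0) (hy : y ∈ openSector) :
    Aminus c R r y = Aplus c R r y + jump c R r y := by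
  rw [Aplus_eq_rayCauchy hc hR hy, Aminus]
  split_ifs with hpos hneg
  · exact I_mul_Gam_of_im_pos hc hR hy hpos
  · rw [I_mul_Gam_of_im_neg hc hR hy hneg]
  · refine limUnder_nhdsGT_zero_eq (d := I)
      (F := fun y => rayCauchy ray (numer R r) (y / c) + jump c R r y)
      ((continuousAt_rayCauchy_numer hc hR r hy).add (continuous_jump c R r).continuousAt) ?_
    filter_upwards [eventually_add_mul_mem_openSector hy I, self_mem_nhdsWithin] with ε mem hε
    rw [← I_mul_Gam_of_im_pos hc hR mem]
    · congr 2
      linear_combination (ε : ℂ) * I_sq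
    · simpa [le_antisymm (not_lt.1 hpos) (not_lt.1 hneg)] using hε

theorem conj_Aplus_conj (hc : 0 < c) (hR : R ≠ 0) (hy : y ∈ openSector) :
    (starRingEnd ℂ) (Aplus c R r ((starRingEnd ℂ) y)) = Aplus c R r y + jump c R r y := by
  obtain ⟨C, hC⟩ := exists_norm_numer_le hR r
  rw [Aplus_eq_rayCauchy hc hR (conj_mem_openSector hy), Aplus_eq_rayCauchy hc hR hy, jump_eq,
    ← conj_rayCauchy_ray_conj (differentiable_numer R r) hC (numer_conj R r)
      (div_mem_openSector hc hy), map_div₀, conj_ofReal]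

theorem Aminus_eq_conj_Aplus_conj (hc : 0 < c) (hR : R ≠ 0) (hy : y ∈ openSector) :
    Aminus c R r y = (starRingEnd ℂ) (Aplus c R r ((starRingEnd ℂ) y)) := by
  rw [Aminus_eq_Aplus_add_jump hc hR hy, conj_Aplus_conj hc hR hy]

theorem Aplus_sub_conj_of_pos (hc : 0 < c) (hR : R ≠ 0) {t : ℝ} (ht : 0 < t) :
    Aplus c R r t - (starRingEnd ℂ) (Aplus c R r t) = -jump c R r t := by
  have := conj_Aplus_conj (r := r) hc hR (ofReal_mem_openSector ht)
  rw [conj_ofReal] at this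
  rw [this, sub_add_cancel_left]

end Continuation

section SectorA

variable {z : ℂ} {Ω : ℝ}

lemma mem_sectorA_of_two_mul_abs_im_le_norm (hre : 0 < z.re) (him : 2 * |z.im| ≤ ‖z‖) :
    z ∈ sectorA := by
  have norm_pos : 0 < ‖z‖ := hre.trans_le (re_le_norm z)
  have abs_div_le : |z.im / ‖z‖| ≤ 1 / 2 := by
    rw [abs_div, abs_of_pos norm_pos, div_le_iff₀ norm_pos]
    linarith
  obtain ⟨neg_le, le⟩ := abs_le.1 abs_div_le
  have arcsin_half : Real.arcsin (1 / 2) = Real.pi / 6 := by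
    rw [← Real.sin_pi_div_six]
    exact Real.arcsin_sin (by linarith [Real.pi_pos]) (by linarith [Real.pi_pos])
  refine ⟨‖z‖, arg z, norm_pos, ?_, ?_, (norm_mul_exp_arg_mul_I z).symm⟩
  · rw [arg_of_re_nonneg hre.le, ← arcsin_half, ← Real.arcsin_neg]
    exact Real.monotone_arcsin neg_le
  · rw [arg_of_re_nonneg hre.le, ← arcsin_half]
    exact Real.monotone_arcsin le

lemma closedBall_subset_sectorA (hΩ : 0 < Ω) : Metric.closedBall (Ω : ℂ) (Ω / 4) ⊆ sectorA := by
  intro z hz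
  rw [mem_closedBall_iff_norm] at hz
  have abs_im_le : |z.im| ≤ Ω / 4 := by simpa using (abs_im_le_norm (z - Ω)).trans hz
  have le_re : 3 / 4 * Ω ≤ z.re := by
    have := (abs_le.1 ((abs_re_le_norm (z - Ω)).trans hz)).1
    rw [sub_re, ofReal_re] at this
    linarith
  exact mem_sectorA_of_two_mul_abs_im_le_norm (by linarith) (by linarith [re_le_norm z])

lemma sectorA_subset_openSector : sectorA ⊆ openSector := by
  rintro _ ⟨ρ, θ, hρ, neg_le, le, rfl⟩
  have abs_le : |θ| ≤ Real.pi / 6 := abs_le.2 ⟨neg_le, le⟩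
  have cos_ge : √3 / 2 ≤ Real.cos |θ| := by
    rw [← Real.cos_pi_div_six]
    exact Real.cos_le_cos_of_nonneg_of_le_pi (abs_nonneg _) (by linarith [Real.pi_pos]) abs_le
  have sin_le : Real.sin |θ| ≤ 1 / 2 := by
    rw [← Real.sin_pi_div_six]
    exact Real.sin_le_sin_of_le_of_le_pi_div_two
      (by linarith [Real.pi_pos, abs_nonneg θ]) (by linarith [Real.pi_pos]) abs_le
  have lt_sqrt : (3 : ℝ) / 2 < √3 := Real.lt_sqrt_of_sq_lt (by norm_num)
  have abs_sin_eq : |Real.sin θ| = Real.sin |θ| :=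
    Real.abs_sin_eq_sin_abs_of_abs_le_pi (by linarith [Real.pi_pos])
  change |(ρ * cexp (θ * I)).im| < 2 / 3 * (ρ * cexp (θ * I)).re
  rw [re_ofReal_mul, im_ofReal_mul, exp_ofReal_mul_I_re, exp_ofReal_mul_I_im, abs_mul,
    abs_of_pos hρ, mul_left_comm, abs_sin_eq, ← Real.cos_abs]
  exact mul_lt_mul_of_pos_left (by linarith) hρ

lemma conj_mem_ball_ofReal {r : ℝ} (hz : z ∈ Metric.ball (Ω : ℂ) r) :
    (starRingEnd ℂ) z ∈ Metric.ball (Ω : ℂ) r := by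
  rwa [Metric.mem_ball, ← conj_ofReal, dist_conj_conj, ← Metric.mem_ball]

lemma quarter_lt_mul_sin_pi_div_eight (hΩ : 0 < Ω) : Ω / 4 < Ω * Real.sin (Real.pi / 8) := by
  have := Real.mul_lt_sin (x := Real.pi / 8) (by positivity) (by linarith [Real.pi_pos])
  rw [show 2 / Real.pi * (Real.pi / 8) = 1 / 4 by field_simp; norm_num] at this
  rw [div_eq_mul_one_div]
  gcongr

end SectorA

section InteractionMatrix

variable {N : ℕ} {Ω c R g : ℝ} {x : Fin N → EuclideanSpace ℝ (Fin 3)} {z : ℂ}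

lemma differentiableOn_AplusMatrix (x : Fin N → EuclideanSpace ℝ (Fin 3)) (hc : 0 < c)
    (hR : R ≠ 0) (j l : Fin N) : DifferentiableOn ℂ (AplusMatrix c R x · j l) openSector :=
  (differentiableOn_rayCauchy_numer hc hR _).congr fun _ hy => Aplus_eq_rayCauchy hc hR hy

lemma exists_norm_AplusMatrix_le (x : Fin N → EuclideanSpace ℝ (Fin 3)) (hc : 0 < c)
    (hR : R ≠ 0) : ∃ M, ∀ y ∈ openSector, ∀ j l, ‖AplusMatrix c R x y j l‖ ≤ M := by
  choose C hC using exists_norm_numer_le hR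
  obtain ⟨M, hM⟩ := Set.finite_range
    (fun p : Fin N × Fin N => 31 * C (dist (x p.1) (x p.2))) |>.bddAbove
  refine ⟨M, fun y hy j l => le_trans ?_ (hM ⟨(j, l), rfl⟩)⟩
  rw [AplusMatrix, Matrix.of_apply, Aplus_eq_rayCauchy hc hR hy]
  exact norm_rayCauchy_le (hC _) (div_mem_openSector hc hy)

open Matrix in
lemma AplusMatrix_sub_conjTranspose (hΩ : 0 < Ω) (hc : 0 < c) (hR : R ≠ 0) :
    AplusMatrix c R x Ω - (AplusMatrix c R x Ω)ᴴ =
      (-((2 * Real.pi * (Ω / c) ^ 2 * Real.exp (-(Ω ^ 2 * R ^ 2 / c ^ 2)) : ℝ) * I)) •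
        Matrix.of fun j l => f (Ω / c : ℝ) (dist (x j) (x l)) := by
  ext j l
  rw [Matrix.sub_apply, conjTranspose_apply, AplusMatrix, of_apply, of_apply, dist_comm (x l),
    ← starRingEnd_apply, Aplus_sub_conj_of_pos hc hR hΩ, jump, Matrix.smul_apply, of_apply,
    smul_eq_mul]
  push_cast
  ring

theorem isStrictlyDissipative_AplusMatrix (hΩ : 0 < Ω) (hc : 0 < c) (hR : R ≠ 0)
    (hx : Function.Injective x) : IsStrictlyDissipative (AplusMatrix c R x Ω) :=
  isStrictlyDissipative_of_sub_conjTranspose (by positivity)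
    (posDef_f_dist finrank_euclideanSpace_fin (div_pos hΩ hc).ne' hx)
    (AplusMatrix_sub_conjTranspose hΩ hc hR)

lemma eventually_isStrictlyDissipative_AplusMatrix (hΩ : 0 < Ω) (hc : 0 < c) (hR : R ≠ 0)
    (hx : Function.Injective x) :
    ∀ᶠ y in 𝓝 (Ω : ℂ), IsStrictlyDissipative (AplusMatrix c R x y) := by
  have continuousAt : ContinuousAt (AplusMatrix c R x) Ω :=
    tendsto_pi_nhds.2 fun j => tendsto_pi_nhds.2 fun l =>
      (differentiableOn_AplusMatrix x hc hR j l).continuousOn.continuousAt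
        (isOpen_openSector.mem_nhds (ofReal_mem_openSector hΩ))
  exact continuousAt.eventually_mem
    (isOpen_setOf_isStrictlyDissipative.mem_nhds (isStrictlyDissipative_AplusMatrix hΩ hc hR hx))

lemma im_pos_of_resDet_eq_zero {A : ℂ → Matrix (Fin N) (Fin N) ℂ} (hc : 0 < c) (hg : 0 < g)
    (hA : IsStrictlyDissipative (A z)) (hz : resDet Ω c g A z = 0) : 0 < z.im := by
  simpa using im_pos_of_det_smul_one_add_smul_eq_zero hA (by positivity) hz

lemma AminusMatrix_eq_map_conj (hc : 0 < c) (hR : R ≠ 0) (hz : z ∈ openSector) :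
    AminusMatrix c R x z = (AplusMatrix c R x ((starRingEnd ℂ) z)).map (starRingEnd ℂ) := by
  ext j l
  exact Aminus_eq_conj_Aplus_conj hc hR hz

lemma resDet_AminusMatrix (hc : 0 < c) (hR : R ≠ 0) (hz : z ∈ openSector) :
    resDet Ω c g (AminusMatrix c R x) z =
      (starRingEnd ℂ) (resDet Ω c g (AplusMatrix c R x) ((starRingEnd ℂ) z)) := by
  rw [resDet, resDet, AminusMatrix_eq_map_conj hc hR hz, RingHom.map_det]
  congr 1
  ext j l
  simp only [Matrix.add_apply, Matrix.smul_apply, Matrix.map_apply, smul_eq_mul,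
    RingHom.mapMatrix_apply, map_add, map_mul, map_sub, conj_conj, conj_ofReal]
  rw [Matrix.one_apply, apply_ite (starRingEnd ℂ), map_one, map_zero]

theorem ListsRoots.resDet_AminusMatrix {y : Fin N → ℂ} (hc : 0 < c) (hR : R ≠ 0)
    (hy : ListsRoots (resDet Ω c g (AplusMatrix c R x)) openSector y) :
    ListsRoots (resDet Ω c g (AminusMatrix c R x)) openSector
      fun j => (starRingEnd ℂ) (y j) :=
  (hy.conj.mono (fun _ hz => conj_mem_openSector hz)
    fun j => conj_mem_openSector (hy.2.1 j)).congr isOpen_openSector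
      fun _ hz => (AtomField.resDet_AminusMatrix hc hR hz).symm

end InteractionMatrix

end AtomField

theorem mainTheorem6 (Ω c R : ℝ) (hΩ : 0 < Ω) (hc : 0 < c) (hR : 0 < R)
    (N : ℕ) (x : Fin N → EuclideanSpace ℝ (Fin 3)) (hx : Function.Injective x) :
    ∃ G₀ : ℝ, 0 < G₀ ∧ ∃ R₀ : ℝ, 0 < R₀ ∧ R₀ < Ω * Real.sin (Real.pi / 8) ∧
      ∀ g : ℝ, 0 < g → g < G₀ →
        ∃ y : Fin N → ℂ,
          (∀ j, y j ∈ Metric.ball (Ω : ℂ) R₀ ∧ y j ∈ AtomField.sectorA ∧ 0 < (y j).im) ∧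
          AtomField.ListsRoots (AtomField.resDet Ω c g (AtomField.AplusMatrix c R x))
            (Metric.ball (Ω : ℂ) R₀) y ∧
          AtomField.ListsRoots (AtomField.resDet Ω c g (AtomField.AplusMatrix c R x))
            AtomField.sectorA y ∧
          AtomField.ListsRoots (AtomField.resDet Ω c g (AtomField.AminusMatrix c R x))
            (Metric.ball (Ω : ℂ) R₀) (fun j => (starRingEnd ℂ) (y j)) ∧
          AtomField.ListsRoots (AtomField.resDet Ω c g (AtomField.AminusMatrix c R x))
            AtomField.sectorA (fun j => (starRingEnd ℂ) (y j)) := by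
  open AtomField in
  obtain ⟨R₁, hR₁, dissipative⟩ := Metric.eventually_nhds_iff_ball.1
    (eventually_isStrictlyDissipative_AplusMatrix hΩ hc hR.ne' hx)
  obtain ⟨M, bounded⟩ := exists_norm_AplusMatrix_le x hc hR.ne'
  have hR₀ : 0 < min R₁ (Ω / 4) := lt_min hR₁ (by positivity)
  have closedBall_subset : Metric.closedBall (Ω : ℂ) (min R₁ (Ω / 4)) ⊆ sectorA :=
    (Metric.closedBall_subset_closedBall (min_le_right _ _)).trans (closedBall_subset_sectorA hΩ)
  have ball_subset := Metric.ball_subset_closedBall.trans closedBall_subset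
  have ball_subset' := ball_subset.trans sectorA_subset_openSector
  obtain ⟨G₀, hG₀, roots⟩ := Metric.eventually_nhds_iff.1
    (eventually_exists_listsRoots_resDet (c := c) hR₀ isOpen_openSector
      (closedBall_subset.trans sectorA_subset_openSector)
      (differentiableOn_AplusMatrix x hc hR.ne') bounded)
  refine ⟨G₀, hG₀, _, hR₀, (min_le_right _ _).trans_lt (quarter_lt_mul_sin_pi_div_eight hΩ),
    fun g hg hgG => ?_⟩
  obtain ⟨y, mem_ball, plus⟩ := roots (y := g) (by simpa [abs_of_pos hg] using hgG)
  have minus := plus.resDet_AminusMatrix hc hR.ne'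
  have conj_mem_ball j := conj_mem_ball_ofReal (mem_ball j)
  exact ⟨y, fun j => ⟨mem_ball j, ball_subset (mem_ball j), im_pos_of_resDet_eq_zero hc hg
      (dissipative _ (Metric.ball_subset_ball (min_le_left _ _) (mem_ball j)))
      (plus.apply_eq_zero j)⟩,
    plus.mono ball_subset' mem_ball,
    plus.mono sectorA_subset_openSector fun j => ball_subset (mem_ball j),
    minus.mono ball_subset' conj_mem_ball,
    minus.mono sectorA_subset_openSector fun j => ball_subset (conj_mem_ball j)⟩
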